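/- **Theorem 1.3.** Let $f:(X,\omega_g)\to(Y,\omega_h)$ be a holomorphic map between Hermitian manifolds (complex manifolds with smooth Hermitian metrics $g$ and $h$). A Hermitian connection $\nabla$ on $T^{1,0}X$ (a connection with $\nabla J=0$ and $\nabla g=0$ on $TX\cong T^{1,0}X$, with torsion ${}^{\nabla}T$ extended complex linearly to $TX\otimes\mathbf C$) is called *suitably skew-symmetric* if $$g\big({}^{\nabla}T(\bar u,v),\bar w\big)=-\,g\big({}^{\nabla}T(\bar w,v),\bar u\big)\qquad\text{for all }u,v,w\in T^{1,0}X.$$ Let $\nabla$ and $\widetilde\nabla$ be suitably skew-symmetric Hermitian connections on $T^{1,0}X$ and $T^{1,0}Y$, and let ${}^{\mathcal T}\nabla$ be the connection they induce on $\mathcal T=\Lambda^{1,0}_X\otimes f^*T^{1,0}Y$. Write $\mathrm{Sym}({}^{\mathcal T}\nabla^{1,0}\partial f)(u,v)=\tfrac12\big(({}^{\mathcal T}\nabla_u\partial f)(v)+({}^{\mathcal T}\nabla_v\partial f)(u)\big)$ for $u,v\in T^{1,0}X$. Let ${}^cT$ and ${}^c\widetilde T$ be the torsions of the Chern connections of $g$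 and $h$, let $R$ and ${}^c\widetilde R$ be their curvatures, with $R_{i\bar jk\bar\ell}=g\big(\nabla_i\nabla_{\bar j}e_k-\nabla_{\bar j}\nabla_ie_k,\bar e_\ell\big)$ for the Chern connection $\nabla$ in a holomorphic coordinate frame $(e_i)$, and let $\mathrm{Ric}^{(2)}_{k\bar\ell}=g^{i\bar j}R_{i\bar jk\bar\ell}$. Let $\Delta_{\omega_g}\varphi=g^{i\bar j}\partial_i\partial_{\bar j}\varphi$ and write $\partial f(e_i)=f_i^\alpha\widetilde e_\alpha$. Then at every point of $X$ $$\Delta_{\omega_g}|\partial f|^2=\big|\mathrm{Sym}\big({}^{\mathcal T}\nabla^{1,0}\partial f\big)\big|^2+\tfrac14\,\big|\partial f\circ{}^cT-{}^c\widetilde T(\partial f\,\cdot,\partial f\,\cdot)\big|^2+g^{k\bar q}g^{p\bar\ell}\,\mathrm{Ric}^{(2)}_{k\bar\ell}\,f_p^\alpha\overline{f_q^\beta}\,h_{\alpha\bar\beta}-g^{i\bar j}g^{p\bar q}\,{}^c\widetilde R_{\alpha\bar\beta\gamma\bar\delta}\,f_i^\alpha\overline{f_j^\beta}f_p^\gamma\overline{f_q^\delta},$$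 where $|S|^2=g^{i\bar j}g^{k\bar\ell}h_{\alpha\bar\beta}S_{ik}^\alpha\overline{S_{j\ell}^\beta}$ (sum over all indices) for $S=S_{ik}^\alpha$, and $|\partial f|^2=g^{i\bar j}h_{\alpha\bar\beta}f_i^\alpha\overline{f_j^\beta}$. Moreover, $\mathrm{Sym}({}^{\mathcal T}\nabla^{1,0}\partial f)$ is the same for every choice of suitably skew-symmetric Hermitian connections $\nabla$ and $\widetilde\nabla$. -/

import Mathlib

open scoped Manifold ContDiff ComplexConjugate
open Bundle

noncomputable section

namespace HermGeom

/-! ### Hermitian linear algebra in a frame -/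

section Linear

variable {E : Type*} [NormedAddCommGroup E] [NormedSpace ℂ E] [FiniteDimensional ℂ E]

/-- The entries `g^{i j̄}` of the inverse of the Gram matrix `g_{i j̄} = G(b_i, b_j)` in a fixed
complex basis `b` of `E`, normalised by `∑ j, g^{i j̄} g_{k j̄} = δ_{ik}`. -/
def gInv (G : E → E → ℂ) (i j : Fin (Module.finrank ℂ E)) : ℂ :=
  (Matrix.of fun k l => G (Module.finBasis ℂ E k) (Module.finBasis ℂ E l))⁻¹ j i

/-- The trace `∑ g^{i j̄} B(b_i, b_j)` of a form `B` (linear in the first and conjugate-linear in the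
second variable) with respect to a Hermitian inner product `G`. It does not depend on the basis;
in a unitary basis it is `∑ B(b_i, b_i)`. -/
def hermTrace (G B : E → E → ℂ) : ℂ :=
  ∑ i, ∑ j, gInv G i j * B (Module.finBasis ℂ E i) (Module.finBasis ℂ E j)

end Linear

/-! ### Complex derivatives, and the Chern connection in holomorphic coordinates -/

section Local

variable {E : Type*} [NormedAddCommGroup E] [NormedSpace ℂ E]
  {V : Type*} [NormedAddCommGroup V] [NormedSpace ℂ V]

/-- The derivative `∂_u s` in the direction of the `(1,0)`-vector `(u - i J u) / 2`. -/
def dz (u : E) (s : E → V) (z : E) : V :=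
  (2⁻¹ : ℂ) • (fderiv ℝ s z u - Complex.I • fderiv ℝ s z (Complex.I • u))

/-- The derivative `∂_{ū} s` in the direction of the `(0,1)`-vector `(u + i J u) / 2`. -/
def dzbar (u : E) (s : E → V) (z : E) : V :=
  (2⁻¹ : ℂ) • (fderiv ℝ s z u + Complex.I • fderiv ℝ s z (Complex.I • u))

variable [FiniteDimensional ℂ E]

/-- The `(1,0)`-part of the Chern connection, in holomorphic coordinates, of a metric with
coefficients `H z u v = g_z(u, v̄)`: `∇_u s = ∂_u s + Γ(u, s)`, where `Γ(u, s)` is determined by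
`g(Γ(u, s), w̄) = (∂_u g)(s, w̄)`, that is `Γ_{ij}^k = g^{k l̄} ∂_i g_{j l̄}`. -/
def chernD10 (H : E → E → E → ℂ) (u : E) (s : E → E) (z : E) : E :=
  dz u s z + ∑ k, ∑ l, (gInv (H z) k l *
    dz u (fun z' => H z' (s z) (Module.finBasis ℂ E l)) z) • Module.finBasis ℂ E k

/-- The `(0,1)`-part of the Chern connection in holomorphic coordinates: `∇_{ū} s = ∂_{ū} s`. -/
def chernD01 (u : E) (s : E → E) (z : E) : E := dzbar u s z

/-- The Chern torsion `T(u, v) = ∇_u v - ∇_v u - [u, v]`, evaluated on coordinate fields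
(whose bracket vanishes). -/
def localChernTorsion (H : E → E → E → ℂ) (z u v : E) : E :=
  chernD10 H u (fun _ => v) z - chernD10 H v (fun _ => u) z

/-- The Chern curvature `R(u, v̄, w, ȳ) = g(∇_u ∇_{v̄} w - ∇_{v̄} ∇_u w - ∇_{[u, v̄]} w, ȳ)`, evaluated on
coordinate fields (whose brackets vanish). -/
def localChernCurvature (H : E → E → E → ℂ) (z u v w y : E) : ℂ :=
  H z (chernD10 H u (chernD01 v (fun _ => w)) z - chernD01 v (chernD10 H u (fun _ => w)) z) y

end Local

/-! ### Complex manifolds -/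

/-- A complex manifold is a real analytic manifold. -/
instance realManifold {E : Type*} [NormedAddCommGroup E] [NormedSpace ℂ E]
    {X : Type*} [TopologicalSpace X] [ChartedSpace E X] [IsManifold 𝓘(ℂ, E) ω X] :
    IsManifold 𝓘(ℝ, E) ω X := by
  refine isManifold_of_contDiffOn 𝓘(ℝ, E) ω X fun e e' he he' => ?_
  have h := HasGroupoid.compatible (G := contDiffGroupoid ω 𝓘(ℂ, E)) he he'
  rw [contDiffGroupoid, mem_groupoid_of_pregroupoid, contDiffPregroupoid] at h
  exact h.1.restrict_scalars ℝ

section Manifold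

variable {E : Type*} [NormedAddCommGroup E] [NormedSpace ℂ E]
  {X : Type*} [TopologicalSpace X] [ChartedSpace E X] [IsManifold 𝓘(ℂ, E) ω X]

/-- The complex structure of the tangent bundle. Throughout, the real tangent bundle with this
complex structure is identified with `T^{1,0}X` through `v ↦ (v - i J v) / 2`. -/
def J (x : X) (v : TangentSpace 𝓘(ℝ, E) x) : TangentSpace 𝓘(ℝ, E) x :=
  (Complex.I • (show E from v) : E)

/-- The coefficients `g(u, v̄)` of a field of sesquilinear forms in the holomorphic chart at `x`:
`FiberBundle.extend E u` is the vector field with constant coefficients `u` in that chart. -/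
def coeff (g : ∀ x : X, TangentSpace 𝓘(ℂ, E) x →ₗ[ℂ] TangentSpace 𝓘(ℂ, E) x →ₗ⋆[ℂ] ℂ)
    (x : X) (z u v : E) : ℂ :=
  g ((chartAt E x).symm z)
    (FiberBundle.extend E (E := (TangentSpace 𝓘(ℝ, E) : X → Type _)) (x := x) u
      ((chartAt E x).symm z))
    (FiberBundle.extend E (E := (TangentSpace 𝓘(ℝ, E) : X → Type _)) (x := x) v
      ((chartAt E x).symm z))

variable (E X) in
/-- A smooth Hermitian metric; `form x u v` is `g_x(u, v̄)` for `u, v ∈ T^{1,0}_x X`. -/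
structure HermitianMetric where
  form : ∀ x : X, TangentSpace 𝓘(ℂ, E) x →ₗ[ℂ] TangentSpace 𝓘(ℂ, E) x →ₗ⋆[ℂ] ℂ
  conj_symm : ∀ x u v, form x v u = conj (form x u v)
  pos : ∀ x u, u ≠ 0 → 0 < (form x u u).re
  smooth : ∀ (x : X) (u v : E),
    ContDiffOn ℝ ∞ (fun z => coeff form x z u v) (chartAt E x).target

variable (E X) in
/-- A connection on the (real) tangent bundle. -/
abbrev Connection := CovariantDerivative 𝓘(ℝ, E) E (TangentSpace 𝓘(ℝ, E) : X → Type _)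

/-- A vector field is (real) differentiable at `x`. -/
def IsDiffAt (σ : ∀ x : X, TangentSpace 𝓘(ℝ, E) x) (x : X) : Prop :=
  MDifferentiableAt 𝓘(ℝ, E) (𝓘(ℝ, E).prod 𝓘(ℝ, E))
    (fun y => (⟨y, σ y⟩ : TangentBundle 𝓘(ℝ, E) X)) x

/-- `D` is a Hermitian connection on `T^{1,0}X`: it is complex (`D J = 0`) and metric (`D g = 0`). -/
structure IsHermitian (g : HermitianMetric E X) (D : Connection E X) : Prop where
  complex : ∀ (σ : ∀ x : X, TangentSpace 𝓘(ℝ, E) x) (x : X), IsDiffAt σ x →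
    ∀ u : TangentSpace 𝓘(ℝ, E) x, D (fun y => J y (σ y)) x u = J x (D σ x u)
  metric : ∀ (σ τ : ∀ x : X, TangentSpace 𝓘(ℝ, E) x) (x : X),
    IsDiffAt σ x → IsDiffAt τ x → ∀ u : TangentSpace 𝓘(ℝ, E) x,
    mfderiv 𝓘(ℝ, E) 𝓘(ℝ, ℂ) (fun y => g.form y (σ y) (τ y)) x u =
      g.form x (D σ x u) (τ x) + g.form x (σ x) (D τ x u)

variable [FiniteDimensional ℂ E]

/-- The `(1,1)`-part of the torsion: `torsion11 D x u v` is the `(1,0)`-component of `T(ū, v)` for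
`u, v ∈ T^{1,0}_x X`, where the torsion `T` of `D` is extended complex bilinearly to `TX ⊗ ℂ`. -/
def torsion11 (D : Connection E X) (x : X) (u v : TangentSpace 𝓘(ℝ, E) x) :
    TangentSpace 𝓘(ℝ, E) x :=
  haveI : CompleteSpace E := FiniteDimensional.complete ℂ E
  (4⁻¹ : ℝ) • (D.torsion x u v + D.torsion x (J x u) (J x v)
    + J x (D.torsion x (J x u) v - D.torsion x u (J x v)))

/-- `g(T(ū, v), w̄) = - g(T(w̄, v), ū)` for all `u, v, w ∈ T^{1,0}X`. -/
def SuitablySkew (g : HermitianMetric E X) (D : Connection E X) : Prop :=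
  ∀ (x : X) (u v w : TangentSpace 𝓘(ℝ, E) x),
    g.form x (torsion11 D x u v) w = - g.form x (torsion11 D x w v) u

/-- The torsion of the Chern connection at `x`. -/
def chernTorsion (g : HermitianMetric E X) (x : X) (u v : TangentSpace 𝓘(ℂ, E) x) :
    TangentSpace 𝓘(ℂ, E) x :=
  localChernTorsion (E := E) (coeff g.form x) (chartAt E x x) u v

/-- The curvature `R(u, v̄, w, ȳ)` of the Chern connection at `x`. -/
def chernCurvature (g : HermitianMetric E X) (x : X) (u v w y : TangentSpace 𝓘(ℂ, E) x) : ℂ :=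
  localChernCurvature (E := E) (coeff g.form x) (chartAt E x x) u v w y

/-- The trace with respect to `g` at `x`. -/
def trace (g : HermitianMetric E X) (x : X)
    (B : TangentSpace 𝓘(ℂ, E) x → TangentSpace 𝓘(ℂ, E) x → ℂ) : ℂ :=
  hermTrace (E := E) (fun u v => g.form x u v) B

/-- The second Chern Ricci curvature `Ric_{k l̄} = g^{i j̄} R_{i j̄ k l̄}`. -/
def chernRicci2 (g : HermitianMetric E X) (x : X) (w y : TangentSpace 𝓘(ℂ, E) x) : ℂ :=
  trace g x fun u v => chernCurvature g x u v w y

/-- The (Chern) Laplacian `Δ φ = g^{i j̄} ∂_i ∂_{j̄} φ`. -/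
def laplacian (g : HermitianMetric E X) (φ : X → ℂ) (x : X) : ℂ :=
  trace g x fun u v =>
    dz (E := E) u (dzbar (E := E) v fun z => φ ((chartAt E x).symm z)) (chartAt E x x)

end Manifold

/-! ### Holomorphic maps -/

section Maps

variable {E : Type*} [NormedAddCommGroup E] [NormedSpace ℂ E]
  {F : Type*} [NormedAddCommGroup F] [NormedSpace ℂ F]
  {X : Type*} [TopologicalSpace X] [ChartedSpace E X] [IsManifold 𝓘(ℂ, E) ω X]
  {Y : Type*} [TopologicalSpace Y] [ChartedSpace F Y] [IsManifold 𝓘(ℂ, F) ω Y]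

/-- The differential `∂f : T^{1,0}X → f^* T^{1,0}Y`. -/
def del (f : X → Y) (x : X) : TangentSpace 𝓘(ℂ, E) x →L[ℂ] TangentSpace 𝓘(ℂ, F) (f x) :=
  mfderiv 𝓘(ℂ, E) 𝓘(ℂ, F) f x

/-- The pullback `f^* D'` of a connection `D'`, acting on sections `s` of `f^* TY`. In the frame
`e_α` of `TY` given by the chart at `f x`, a section `s = s^α e_α` has
`(f^* D')_u s = ds^α(u) e_α + s^α(x) D'_{df(u)} e_α`. -/
def pullbackConnection (D' : Connection F Y) (f : X → Y)
    (s : ∀ x : X, TangentSpace 𝓘(ℝ, F) (f x)) (x : X) (u : TangentSpace 𝓘(ℝ, E) x) :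
    TangentSpace 𝓘(ℝ, F) (f x) :=
  (show F from mfderiv 𝓘(ℝ, E) 𝓘(ℝ, F) (fun y : X =>
      (trivializationAt F (TangentSpace 𝓘(ℝ, F) : Y → Type _) (f x) ⟨f y, s y⟩).2) x u)
    + (show F from
      D' (FiberBundle.extend F (s x)) (f x) (mfderiv 𝓘(ℝ, E) 𝓘(ℝ, F) f x u))

/-- The connection on `Hom(T^{1,0}X, f^* T^{1,0}Y) = Λ^{1,0}_X ⊗ f^* T^{1,0}Y` induced by `D` and
`D'`: `(∇_u A)(v) = (f^* D')_u (A v) - A (D_u v)`. -/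
def inducedConnection (D : Connection E X) (D' : Connection F Y) (f : X → Y)
    (A : ∀ x : X, TangentSpace 𝓘(ℂ, E) x →L[ℂ] TangentSpace 𝓘(ℂ, F) (f x))
    (x : X) (u v : TangentSpace 𝓘(ℝ, E) x) : TangentSpace 𝓘(ℝ, F) (f x) :=
  (show F from pullbackConnection D' f (fun y => A y (FiberBundle.extend E v y)) x u)
    - (show F from A x (D (FiberBundle.extend E v) x u))

/-- The Hessian `∇^{1,0} ∂f`: the value of `∇_U (∂f)` on `v` with `U = (u - i J u) / 2`. -/
def hessian (D : Connection E X) (D' : Connection F Y) (f : X → Y)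
    (x : X) (u v : TangentSpace 𝓘(ℝ, E) x) : TangentSpace 𝓘(ℝ, F) (f x) :=
  (2⁻¹ : ℝ) • (inducedConnection D D' f (del f) x u v
    - J (f x) (inducedConnection D D' f (del f) x (J x u) v))

/-- The symmetric part of the Hessian. -/
def symHessian (D : Connection E X) (D' : Connection F Y) (f : X → Y)
    (x : X) (u v : TangentSpace 𝓘(ℝ, E) x) : TangentSpace 𝓘(ℝ, F) (f x) :=
  (2⁻¹ : ℝ) • (hessian D D' f x u v + hessian D D' f x v u)

variable [FiniteDimensional ℂ E]

/-- The energy density `|∂f|² = g^{i j̄} h(∂f e_i, conj (∂f e_j))`. -/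
def energyDensity (g : HermitianMetric E X) (h : HermitianMetric F Y) (f : X → Y) (x : X) : ℂ :=
  trace g x fun u v => h.form (f x) (del f x u) (del f x v)

/-- The squared norm `g^{i j̄} g^{k l̄} h(S(e_i, e_k), conj S(e_j, e_l))` of a complex bilinear map
`S : T^{1,0}_x X × T^{1,0}_x X → T^{1,0}_{f x} Y`. -/
def normSq (g : HermitianMetric E X) (h : HermitianMetric F Y) (f : X → Y) (x : X)
    (S : TangentSpace 𝓘(ℂ, E) x → TangentSpace 𝓘(ℂ, E) x → TangentSpace 𝓘(ℂ, F) (f x)) : ℂ :=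
  trace g x fun u v => trace g x fun w y => h.form (f x) (S u w) (S v y)

/-- The source term `(Ric^{(2)})^♯ ⊗ h (∂f, conj ∂f)`, that is
`g^{k q̄} g^{p l̄} Ric_{k l̄} h(∂f e_p, conj (∂f e_q))`. -/
def ricciTerm (g : HermitianMetric E X) (h : HermitianMetric F Y) (f : X → Y) (x : X) : ℂ :=
  trace g x fun u v => trace g x fun w y =>
    chernRicci2 g x u y * h.form (f x) (del f x w) (del f x v)

variable [FiniteDimensional ℂ F]

/-- `∂f ∘ T - T'(∂f ·, ∂f ·)` for the Chern torsions `T` of `g` and `T'` of `h`. -/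
def torsionDefect (g : HermitianMetric E X) (h : HermitianMetric F Y) (f : X → Y) (x : X)
    (u v : TangentSpace 𝓘(ℂ, E) x) : TangentSpace 𝓘(ℂ, F) (f x) :=
  del f x (chernTorsion g x u v) - chernTorsion h (f x) (del f x u) (del f x v)

/-- The target curvature term `g^♯ ⊗ g^♯ ⊗ R' (∂f, conj ∂f, ∂f, conj ∂f)`, that is
`g^{i j̄} g^{p q̄} R'(∂f e_i, conj (∂f e_j), ∂f e_p, conj (∂f e_q))`. -/
def curvatureTerm (g : HermitianMetric E X) (h : HermitianMetric F Y) (f : X → Y) (x : X) : ℂ :=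
  trace g x fun u v => trace g x fun w y =>
    chernCurvature h (f x) (del f x u) (del f x v) (del f x w) (del f x y)

end Maps

end HermGeom

end

noncomputable section

namespace HermGeom

/-! ### Wirtinger calculus -/

section Wirtinger

open Topology

variable {E : Type*} [NormedAddCommGroup E] [NormedSpace ℂ E]
  {F : Type*} [NormedAddCommGroup F] [NormedSpace ℂ F]
  {V : Type*} [NormedAddCommGroup V] [NormedSpace ℂ V]
  {W : Type*} [NormedAddCommGroup W] [NormedSpace ℂ W]

/-! The formula is a computation in holomorphic charts. Let `H` and `K` be the metric coefficients,
`Γ` and `Γ'` their Chern connection forms (`christoffel`), `b_j` a constant basis of the model space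
and `e_j` the `H`-dual frame, so that the energy is `∑ K(df e_j, df b_j)`. Three facts drive the
derivation: `f` is holomorphic, so `∂̄` kills `df`; the dual frame satisfies `∂_u e_j = -Γ(u, e_j)`;
and `∂_{v̄} Γ` is minus the Chern curvature. Put `S(u, w) = ∂∂f(u, w) + Γ'(df u, df w) - df Γ(u, w)`
(`chernHessian`). Then `∂_u` of the energy is `∑ K(S(u, e_j), df b_j)` (`dz_localEnergy`). Applying
`∂_{v̄}` gives `∑ K(S(u, e_j), S(v, b_j))` plus a source and a target curvature term
(`dzbar_dz_localEnergy`).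

Tracing yields `|S|²`, the second Ricci term and the target curvature term. The square splits
orthogonally into symmetric and antisymmetric parts (`hermTrace_symm_add_antisymm`). Since `∂∂f` is
symmetric, the antisymmetrization of `S` involves only the two Chern torsions, which accounts for
the torsion term and its factor 1/4 (`local_bochner`).

General connections enter only through `symm_connection_eq`. If `A` is the connection form of a
Hermitian connection, compatibility with the metric says that `Γ - A^{1,0}` is adjoint to `A^{0,1}`,
and `A^{0,1}` is the (1,1)-torsion. Suitable skew-symmetry makes that difference antisymmetric, so
`A^{1,0}` and `Γ` have the same symmetrization. The symmetrized Hessian is therefore always that of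
the Chern connections (`symHessianForm_eq`), which gives both the formula and the independence of
choices. -/

lemma dz_congr {s t : E → V} {z : E} (h : s =ᶠ[𝓝 z] t) (u : E) : dz u s z = dz u t z := by
  simp only [dz, h.fderiv_eq]

lemma dzbar_congr {s t : E → V} {z : E} (h : s =ᶠ[𝓝 z] t) (u : E) :
    dzbar u s z = dzbar u t z := by
  simp only [dzbar, h.fderiv_eq]

@[simp] lemma dz_const (u : E) (c : V) (z : E) : dz u (fun _ => c) z = 0 := by
  simp [dz]

@[simp] lemma dzbar_const (u : E) (c : V) (z : E) : dzbar u (fun _ => c) z = 0 := by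
  simp [dzbar]

lemma dz_add {s t : E → V} {z : E} (hs : DifferentiableAt ℝ s z) (ht : DifferentiableAt ℝ t z)
    (u : E) : dz u (fun z => s z + t z) z = dz u s z + dz u t z := by
  simp only [dz, fderiv_fun_add hs ht, add_apply]
  module

lemma dzbar_add {s t : E → V} {z : E} (hs : DifferentiableAt ℝ s z)
    (ht : DifferentiableAt ℝ t z) (u : E) :
    dzbar u (fun z => s z + t z) z = dzbar u s z + dzbar u t z := by
  simp only [dzbar, fderiv_fun_add hs ht, add_apply]
  module

lemma dzbar_sub {s t : E → V} {z : E} (hs : DifferentiableAt ℝ s z)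
    (ht : DifferentiableAt ℝ t z) (u : E) :
    dzbar u (fun z => s z - t z) z = dzbar u s z - dzbar u t z := by
  simp only [dzbar, fderiv_fun_sub hs ht, sub_apply]
  module

lemma dz_sum {ι : Type*} [Fintype ι] {s : ι → E → V} {z : E}
    (hs : ∀ i, DifferentiableAt ℝ (s i) z) (u : E) :
    dz u (fun z => ∑ i, s i z) z = ∑ i, dz u (s i) z := by
  simp only [dz, fderiv_fun_sum fun i _ => hs i, sum_apply,
    Finset.smul_sum, Finset.sum_sub_distrib, smul_sub]

lemma dzbar_sum {ι : Type*} [Fintype ι] {s : ι → E → V} {z : E}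
    (hs : ∀ i, DifferentiableAt ℝ (s i) z) (u : E) :
    dzbar u (fun z => ∑ i, s i z) z = ∑ i, dzbar u (s i) z := by
  simp only [dzbar, fderiv_fun_sum fun i _ => hs i, sum_apply,
    Finset.smul_sum, Finset.sum_add_distrib, smul_add]

lemma fderiv_conj (s : E → ℂ) (z u : E) :
    fderiv ℝ (fun z => conj (s z)) z u = conj (fderiv ℝ s z u) := by
  have := (Complex.conjCLE.comp_fderiv (f := s) (x := z))
  exact congrArg (fun L : E →L[ℝ] ℂ => L u) this

lemma dzbar_conj (u : E) (s : E → ℂ) (z : E) :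
    dzbar u (fun z => conj (s z)) z = conj (dz u s z) := by
  simp [dz, dzbar, fderiv_conj, sub_eq_add_neg, Complex.conj_ofNat]

/-- A holomorphic function has the expected real derivative. -/
lemma fderiv_real_of_holomorphic {s : E → V} {z : E} (hs : DifferentiableAt ℂ s z) (u : E) :
    fderiv ℝ s z u = fderiv ℂ s z u := by
  rw [hs.fderiv_restrictScalars ℝ]; rfl

lemma dz_of_holomorphic {s : E → V} {z : E} (hs : DifferentiableAt ℂ s z) (u : E) :
    dz u s z = fderiv ℂ s z u := by
  simp only [dz, fderiv_real_of_holomorphic hs, map_smul, smul_smul, Complex.I_mul_I]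
  module

lemma dzbar_of_holomorphic {s : E → V} {z : E} (hs : DifferentiableAt ℂ s z) (u : E) :
    dzbar u s z = 0 := by
  simp only [dzbar, fderiv_real_of_holomorphic hs, map_smul, smul_smul, Complex.I_mul_I]
  module

lemma fderiv_comp_holomorphic {f : E → F} {s : F → V} {z : E} (hf : DifferentiableAt ℂ f z)
    (hs : DifferentiableAt ℝ s (f z)) (u : E) :
    fderiv ℝ (fun z => s (f z)) z u = fderiv ℝ s (f z) (fderiv ℂ f z u) := by
  rw [← fderiv_real_of_holomorphic hf, fderiv_fun_comp z hs (hf.restrictScalars ℝ)]; rfl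

/-- The differential of `f` commutes with multiplication by `i`, so the chain rule does not mix
types. -/
lemma dz_comp_holomorphic {f : E → F} {s : F → V} {z : E} (hf : DifferentiableAt ℂ f z)
    (hs : DifferentiableAt ℝ s (f z)) (u : E) :
    dz u (fun z => s (f z)) z = dz (fderiv ℂ f z u) s (f z) := by
  simp only [dz, fderiv_comp_holomorphic hf hs, map_smul]

lemma dzbar_comp_holomorphic {f : E → F} {s : F → V} {z : E} (hf : DifferentiableAt ℂ f z)
    (hs : DifferentiableAt ℝ s (f z)) (u : E) :
    dzbar u (fun z => s (f z)) z = dzbar (fderiv ℂ f z u) s (f z) := by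
  simp only [dzbar, fderiv_comp_holomorphic hf hs, map_smul]

/-! ### Second Wirtinger derivatives of smooth functions -/

section Smooth

variable {U : Set E} (hU : IsOpen U)
include hU

lemma smooth_fderiv_apply {s : E → V} (hs : ContDiffOn ℝ ∞ s U) (u : E) :
    ContDiffOn ℝ ∞ (fun z => fderiv ℝ s z u) U :=
  (hs.fderiv_of_isOpen hU (by simp)).clm_apply contDiffOn_const

lemma smooth_dz {s : E → V} (hs : ContDiffOn ℝ ∞ s U) (u : E) : ContDiffOn ℝ ∞ (dz u s) U :=
  ((smooth_fderiv_apply hU hs u).sub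
    ((smooth_fderiv_apply hU hs _).const_smul Complex.I)).const_smul (2⁻¹ : ℂ)

lemma smooth_differentiableAt {s : E → V} (hs : ContDiffOn ℝ ∞ s U) {z : E} (hz : z ∈ U) :
    DifferentiableAt ℝ s z :=
  (hs.contDiffAt (hU.mem_nhds hz)).differentiableAt (by simp)

lemma fderiv_dz {s : E → V} (hs : ContDiffOn ℝ ∞ s U) {z : E} (hz : z ∈ U) (u v : E) :
    fderiv ℝ (dz u s) z v = (2⁻¹ : ℂ) • (fderiv ℝ (fderiv ℝ s) z v u
      - Complex.I • fderiv ℝ (fderiv ℝ s) z v (Complex.I • u)) := by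
  have h2 : DifferentiableAt ℝ (fderiv ℝ s) z :=
    smooth_differentiableAt hU (hs.fderiv_of_isOpen hU (by simp)) hz
  have hd (w : E) : HasFDerivAt (fun z => fderiv ℝ s z w)
      ((fderiv ℝ (fderiv ℝ s) z).flip w) z := by
    simpa using h2.hasFDerivAt.clm_apply (hasFDerivAt_const w z)
  have := ((hd u).sub ((hd (Complex.I • u)).const_smul Complex.I)).const_smul (2⁻¹ : ℂ)
  exact congrArg (fun L : E →L[ℝ] V => L v) this.fderiv

lemma fderiv_dzbar {s : E → V} (hs : ContDiffOn ℝ ∞ s U) {z : E} (hz : z ∈ U) (u v : E) :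
    fderiv ℝ (dzbar u s) z v = (2⁻¹ : ℂ) • (fderiv ℝ (fderiv ℝ s) z v u
      + Complex.I • fderiv ℝ (fderiv ℝ s) z v (Complex.I • u)) := by
  have h2 : DifferentiableAt ℝ (fderiv ℝ s) z :=
    smooth_differentiableAt hU (hs.fderiv_of_isOpen hU (by simp)) hz
  have hd (w : E) : HasFDerivAt (fun z => fderiv ℝ s z w)
      ((fderiv ℝ (fderiv ℝ s) z).flip w) z := by
    simpa using h2.hasFDerivAt.clm_apply (hasFDerivAt_const w z)
  have := ((hd u).add ((hd (Complex.I • u)).const_smul Complex.I)).const_smul (2⁻¹ : ℂ)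
  exact congrArg (fun L : E →L[ℝ] V => L v) this.fderiv

/-- `∂_u` and `∂_{v̄}` commute. -/
lemma dz_dzbar_comm {s : E → V} (hs : ContDiffOn ℝ ∞ s U) {z : E} (hz : z ∈ U) (u v : E) :
    dz u (dzbar v s) z = dzbar v (dz u s) z := by
  have hsym : IsSymmSndFDerivAt ℝ s z :=
    (hs.contDiffAt (hU.mem_nhds hz)).isSymmSndFDerivAt
      (by rw [minSmoothness_of_isRCLikeNormedField]; exact WithTop.coe_le_coe.2 le_top)
  have e (a b : E) := hsym a b
  rw [dz, dzbar]
  simp only [fderiv_dz hU hs hz, fderiv_dzbar hU hs hz]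
  rw [e v u, e v (Complex.I • u), e (Complex.I • v) u, e (Complex.I • v) (Complex.I • u)]
  module

end Smooth

variable [FiniteDimensional ℂ V]

/-- A complex linear map as a continuous real linear map. -/
def realLin (L : V →ₗ[ℂ] W) : V →L[ℝ] W :=
  haveI : FiniteDimensional ℝ V := FiniteDimensional.complexToReal V
  LinearMap.toContinuousLinearMap (L.restrictScalars ℝ)

@[simp] lemma realLin_apply (L : V →ₗ[ℂ] W) (v : V) : realLin L v = L v := rfl

/-- A sesquilinear form as a continuous real bilinear map. -/
def realForm (Q : V →ₗ[ℂ] V →ₗ⋆[ℂ] ℂ) : V →L[ℝ] V →L[ℝ] ℂ :=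
  haveI : FiniteDimensional ℝ V := FiniteDimensional.complexToReal V
  LinearMap.toContinuousLinearMap
    { toFun := fun u => LinearMap.toContinuousLinearMap
        { toFun := fun v => Q u v
          map_add' := fun a b => map_add _ a b
          map_smul' := fun r b => by
            rw [← Complex.coe_smul, LinearMap.map_smulₛₗ]; simp }
      map_add' := fun a b => by ext v; simp
      map_smul' := fun r b => by
        ext v
        rw [← Complex.coe_smul, LinearMap.map_smul]; simp }

@[simp] lemma realForm_apply (Q : V →ₗ[ℂ] V →ₗ⋆[ℂ] ℂ) (u v : V) : realForm Q u v = Q u v := rfl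

/-- In finite dimension, smoothness on each fixed vector is smoothness in operator norm. This makes
product rules with moving arguments available for data known only coefficientwise. -/
lemma smooth_realLin {L : E → V →ₗ[ℂ] W} {U : Set E}
    (hL : ∀ v, ContDiffOn ℝ ∞ (fun z => L z v) U) :
    ContDiffOn ℝ ∞ (fun z => realLin (L z)) U := by
  have : FiniteDimensional ℝ V := FiniteDimensional.complexToReal V
  exact contDiffOn_clm_apply.2 hL

lemma smooth_realForm {Q : E → V →ₗ[ℂ] V →ₗ⋆[ℂ] ℂ} {U : Set E}
    (hQ : ∀ u v, ContDiffOn ℝ ∞ (fun z => Q z u v) U) :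
    ContDiffOn ℝ ∞ (fun z => realForm (Q z)) U := by
  have : FiniteDimensional ℝ V := FiniteDimensional.complexToReal V
  exact contDiffOn_clm_apply.2 fun u => contDiffOn_clm_apply.2 fun v => hQ u v

lemma smooth_lin {L : E → V →ₗ[ℂ] W} {s : E → V} {U : Set E}
    (hL : ∀ v, ContDiffOn ℝ ∞ (fun z => L z v) U) (hs : ContDiffOn ℝ ∞ s U) :
    ContDiffOn ℝ ∞ (fun z => L z (s z)) U :=
  (smooth_realLin hL).clm_apply hs

lemma smooth_form {Q : E → V →ₗ[ℂ] V →ₗ⋆[ℂ] ℂ} {s t : E → V} {U : Set E}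
    (hQ : ∀ u v, ContDiffOn ℝ ∞ (fun z => Q z u v) U)
    (hs : ContDiffOn ℝ ∞ s U) (ht : ContDiffOn ℝ ∞ t U) :
    ContDiffOn ℝ ∞ (fun z => Q z (s z) (t z)) U :=
  ((smooth_realForm hQ).clm_apply hs).clm_apply ht

/-! ### Leibniz rules for families of linear maps and sesquilinear forms -/

section Leibniz

variable {U : Set E} (hU : IsOpen U)
include hU

lemma fderiv_lin {L : E → V →ₗ[ℂ] W} {s : E → V}
    (hL : ∀ v, ContDiffOn ℝ ∞ (fun z => L z v) U) (hs : ContDiffOn ℝ ∞ s U) {z : E} (hz : z ∈ U)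
    (u : E) :
    fderiv ℝ (fun z => L z (s z)) z u =
      fderiv ℝ (fun z' => L z' (s z)) z u + L z (fderiv ℝ s z u) := by
  have hR := (smooth_differentiableAt hU (smooth_realLin hL) hz).hasFDerivAt
  have h1 := (hR.clm_apply (smooth_differentiableAt hU hs hz).hasFDerivAt).fderiv
  -- The product rule with the argument frozen at `s z` identifies the summand in which only `L` is
  -- differentiated.
  have h2 := (hR.clm_apply (hasFDerivAt_const (s z) z)).fderiv
  replace h1 := congrArg (fun L : E →L[ℝ] W => L u) h1
  replace h2 := congrArg (fun L : E →L[ℝ] W => L u) h2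
  simp only [realLin_apply] at h1 h2
  rw [h1, h2]
  simp [add_comm]

lemma fderiv_form {Q : E → V →ₗ[ℂ] V →ₗ⋆[ℂ] ℂ} {s t : E → V}
    (hQ : ∀ u v, ContDiffOn ℝ ∞ (fun z => Q z u v) U)
    (hs : ContDiffOn ℝ ∞ s U) (ht : ContDiffOn ℝ ∞ t U) {z : E} (hz : z ∈ U) (u : E) :
    fderiv ℝ (fun z => Q z (s z) (t z)) z u =
      fderiv ℝ (fun z' => Q z' (s z) (t z)) z u + Q z (fderiv ℝ s z u) (t z)
        + Q z (s z) (fderiv ℝ t z u) := by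
  have hR := (((smooth_realForm hQ).contDiffAt (hU.mem_nhds hz)).differentiableAt
    (by simp)).hasFDerivAt
  have h1 := ((hR.clm_apply (smooth_differentiableAt hU hs hz).hasFDerivAt).clm_apply
    (smooth_differentiableAt hU ht hz).hasFDerivAt).fderiv
  have h2 := ((hR.clm_apply (hasFDerivAt_const (s z) z)).clm_apply
    (hasFDerivAt_const (t z) z)).fderiv
  replace h1 := congrArg (fun L : E →L[ℝ] ℂ => L u) h1
  replace h2 := congrArg (fun L : E →L[ℝ] ℂ => L u) h2
  simp only [realForm_apply] at h1 h2
  rw [h1, h2]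
  simp
  ring

lemma dz_lin {L : E → V →ₗ[ℂ] W} {s : E → V}
    (hL : ∀ v, ContDiffOn ℝ ∞ (fun z => L z v) U) (hs : ContDiffOn ℝ ∞ s U) {z : E} (hz : z ∈ U)
    (u : E) :
    dz u (fun z => L z (s z)) z = dz u (fun z' => L z' (s z)) z + L z (dz u s z) := by
  simp only [dz, fderiv_lin hU hL hs hz, map_smul, map_sub]
  module

lemma dzbar_lin {L : E → V →ₗ[ℂ] W} {s : E → V}
    (hL : ∀ v, ContDiffOn ℝ ∞ (fun z => L z v) U) (hs : ContDiffOn ℝ ∞ s U) {z : E} (hz : z ∈ U)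
    (u : E) :
    dzbar u (fun z => L z (s z)) z = dzbar u (fun z' => L z' (s z)) z + L z (dzbar u s z) := by
  simp only [dzbar, fderiv_lin hU hL hs hz, map_smul, map_add]
  module

/-- The second slot is conjugate-linear, so `∂_u` acts on it as `∂_{ū}`. -/
lemma dz_form {Q : E → V →ₗ[ℂ] V →ₗ⋆[ℂ] ℂ} {s t : E → V}
    (hQ : ∀ u v, ContDiffOn ℝ ∞ (fun z => Q z u v) U)
    (hs : ContDiffOn ℝ ∞ s U) (ht : ContDiffOn ℝ ∞ t U) {z : E} (hz : z ∈ U) (u : E) :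
    dz u (fun z => Q z (s z) (t z)) z =
      dz u (fun z' => Q z' (s z) (t z)) z + Q z (dz u s z) (t z) + Q z (s z) (dzbar u t z) := by
  simp only [dz, dzbar, fderiv_form hU hQ hs ht hz, map_smul, map_sub, map_add,
    LinearMap.map_smulₛₗ, LinearMap.sub_apply, LinearMap.smul_apply, smul_eq_mul,
    map_inv₀, map_ofNat, Complex.conj_I]
  ring

lemma dzbar_form {Q : E → V →ₗ[ℂ] V →ₗ⋆[ℂ] ℂ} {s t : E → V}
    (hQ : ∀ u v, ContDiffOn ℝ ∞ (fun z => Q z u v) U)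
    (hs : ContDiffOn ℝ ∞ s U) (ht : ContDiffOn ℝ ∞ t U) {z : E} (hz : z ∈ U) (u : E) :
    dzbar u (fun z => Q z (s z) (t z)) z =
      dzbar u (fun z' => Q z' (s z) (t z)) z + Q z (dzbar u s z) (t z)
        + Q z (s z) (dz u t z) := by
  simp only [dz, dzbar, fderiv_form hU hQ hs ht hz, map_smul, map_sub, map_add,
    LinearMap.map_smulₛₗ, LinearMap.add_apply, LinearMap.smul_apply, smul_eq_mul,
    map_inv₀, map_ofNat, Complex.conj_I]
  ring

end Leibniz

end Wirtinger

/-! ### Dual frames and traces -/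

section Trace

variable {V : Type*} [NormedAddCommGroup V] [NormedSpace ℂ V]

/-- A positive definite Hermitian form. -/
structure IsPosHermitian (G : V →ₗ[ℂ] V →ₗ⋆[ℂ] ℂ) : Prop where
  conj_symm : ∀ u v, G v u = conj (G u v)
  pos : ∀ u, u ≠ 0 → 0 < (G u u).re

lemma IsPosHermitian.eq_zero {G : V →ₗ[ℂ] V →ₗ⋆[ℂ] ℂ} (hG : IsPosHermitian G) {u : V}
    (h : ∀ v, G u v = 0) : u = 0 := by
  by_contra hu
  simpa [h u] using hG.pos u hu

lemma IsPosHermitian.ext {G : V →ₗ[ℂ] V →ₗ⋆[ℂ] ℂ} (hG : IsPosHermitian G) {u u' : V}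
    (h : ∀ v, G u v = G u' v) : u = u' :=
  sub_eq_zero.1 <| hG.eq_zero fun v => by rw [map_sub, LinearMap.sub_apply, h, sub_self]

/-- Frames `e` and `c` that are dual to each other with respect to `G`. -/
structure IsDualPair {ι : Type*} [Fintype ι] (G : V →ₗ[ℂ] V →ₗ⋆[ℂ] ℂ) (e c : ι → V) : Prop where
  left : ∀ w, ∑ k, G w (c k) • e k = w
  right : ∀ y, ∑ k, G y (e k) • c k = y

/-- Traces computed in two dual pairs agree. -/
lemma IsDualPair.sum_eq {ι κ : Type*} [Fintype ι] [Fintype κ] {G : V →ₗ[ℂ] V →ₗ⋆[ℂ] ℂ}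
    (hG : IsPosHermitian G) {e c : ι → V} {e' c' : κ → V} (h : IsDualPair G e c)
    (h' : IsDualPair G e' c') (B : V →ₗ[ℂ] V →ₗ⋆[ℂ] ℂ) :
    ∑ j, B (e' j) (c' j) = ∑ k, B (e k) (c k) := by
  calc ∑ j, B (e' j) (c' j) = ∑ j, ∑ k, G (e' j) (c k) * B (e k) (c' j) := by
        refine Finset.sum_congr rfl fun j _ => ?_
        conv_lhs => rw [← h.left (e' j)]
        simp
    _ = ∑ k, ∑ j, G (e' j) (c k) * B (e k) (c' j) := Finset.sum_comm
    _ = ∑ k, B (e k) (c k) := by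
        refine Finset.sum_congr rfl fun k _ => ?_
        conv_rhs => rw [← h'.right (c k)]
        simp [← hG.conj_symm]

/-- The pullback of a sesquilinear form. -/
def pullForm {W : Type*} [AddCommGroup W] [Module ℂ W] (B : W →ₗ[ℂ] W →ₗ⋆[ℂ] ℂ)
    (L : V →ₗ[ℂ] W) : V →ₗ[ℂ] V →ₗ⋆[ℂ] ℂ :=
  LinearMap.mk₂'ₛₗ _ _ (fun u v => B (L u) (L v)) (by simp) (by simp) (by simp) (by simp)

@[simp] lemma pullForm_apply {W : Type*} [AddCommGroup W] [Module ℂ W]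
    (B : W →ₗ[ℂ] W →ₗ⋆[ℂ] ℂ) (L : V →ₗ[ℂ] W) (u v : V) :
    pullForm B L u v = B (L u) (L v) := rfl

lemma IsPosHermitian.pullForm {G : V →ₗ[ℂ] V →ₗ⋆[ℂ] ℂ} (hG : IsPosHermitian G)
    (L : V ≃ₗ[ℂ] V) : IsPosHermitian (pullForm G (L : V →ₗ[ℂ] V)) where
  conj_symm u v := hG.conj_symm _ _
  pos u hu := hG.pos _ (by simpa using hu)

variable [FiniteDimensional ℂ V]

/-- The frame dual to the standard basis with respect to `G`. -/
def dualFrame (G : V → V → ℂ) (j : Fin (Module.finrank ℂ V)) : V :=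
  ∑ i, gInv G i j • Module.finBasis ℂ V i

/-- A kernel vector `x` of the Gram matrix makes `∑ conj(x_l) b_l` orthogonal to every vector, hence
zero by definiteness. The conjugates appear because columns index the conjugate-linear slot. -/
lemma IsPosHermitian.gram_det_ne_zero {G : V →ₗ[ℂ] V →ₗ⋆[ℂ] ℂ} (hG : IsPosHermitian G) :
    (Matrix.of fun k l => G (Module.finBasis ℂ V k) (Module.finBasis ℂ V l)).det ≠ 0 := by
  intro h0
  obtain ⟨x, hx, hM⟩ := Matrix.exists_mulVec_eq_zero_iff.2 h0
  apply hx
  set b := Module.finBasis ℂ V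
  have hy : ∑ l, conj (x l) • b l = 0 := by
    have h1 (k) : G (b k) (∑ l, conj (x l) • b l) = 0 := by
      have := congrFun hM k
      simp only [Matrix.mulVec, dotProduct, Matrix.of_apply, Pi.zero_apply] at this
      simpa [mul_comm] using this
    have h2 : ∀ v, G (∑ l, conj (x l) • b l) v = 0 := by
      generalize ∑ l, conj (x l) • b l = y at h1 ⊢
      intro v
      rw [hG.conj_symm v, ← b.sum_repr v]
      simp only [map_sum, map_smul, LinearMap.sum_apply, LinearMap.smul_apply, h1, smul_zero,
        Finset.sum_const_zero, map_zero]
    exact hG.eq_zero h2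
  have hli := Fintype.linearIndependent_iff.1 b.linearIndependent _ hy
  funext l
  simpa using hli l

/-- This is `M⁻¹ M = 1` read entrywise, with the index transposition built into `gInv`. -/
lemma IsPosHermitian.dualFrame_apply {G : V →ₗ[ℂ] V →ₗ⋆[ℂ] ℂ} (hG : IsPosHermitian G)
    (j k : Fin (Module.finrank ℂ V)) :
    G (dualFrame (fun u v => G u v) j) (Module.finBasis ℂ V k) = if j = k then 1 else 0 := by
  have h := congrFun (congrFun (Matrix.nonsing_inv_mul _
    (isUnit_iff_ne_zero.2 hG.gram_det_ne_zero)) j) k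
  rw [Matrix.mul_apply, Matrix.one_apply] at h
  simpa [dualFrame, gInv] using h

lemma IsPosHermitian.ext_basis {G : V →ₗ[ℂ] V →ₗ⋆[ℂ] ℂ} (hG : IsPosHermitian G) {u u' : V}
    (h : ∀ k, G u (Module.finBasis ℂ V k) = G u' (Module.finBasis ℂ V k)) : u = u' := by
  refine hG.ext fun v => ?_
  rw [← (Module.finBasis ℂ V).sum_repr v]
  simp only [map_sum, LinearMap.map_smulₛₗ, h]

lemma IsPosHermitian.isDualPair {G : V →ₗ[ℂ] V →ₗ⋆[ℂ] ℂ} (hG : IsPosHermitian G) :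
    IsDualPair G (dualFrame fun u v => G u v) (Module.finBasis ℂ V) where
  left w := hG.ext_basis fun k => by simp [hG.dualFrame_apply]
  right y := by
    conv_rhs => rw [← (Module.finBasis ℂ V).sum_repr y]
    refine Finset.sum_congr rfl fun k _ => ?_
    congr 1
    rw [hG.conj_symm]
    conv_lhs => rw [← (Module.finBasis ℂ V).sum_repr y]
    simp only [map_sum, LinearMap.map_smulₛₗ, hG.dualFrame_apply]
    simp [apply_ite]

/-- The trace in terms of the dual frame. -/
lemma hermTrace_eq_sum (G : V → V → ℂ) (B : V → V →ₗ[ℂ] ℂ) :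
    hermTrace G (fun u v => B v u) =
      ∑ j, B (Module.finBasis ℂ V j) (dualFrame G j) := by
  simp only [hermTrace, dualFrame, map_sum, map_smul, smul_eq_mul]
  exact Finset.sum_comm

lemma hermTrace_eq_sum_form (G : V → V → ℂ) (B : V →ₗ[ℂ] V →ₗ⋆[ℂ] ℂ) :
    hermTrace G (fun u v => B u v) =
      ∑ j, B (dualFrame G j) (Module.finBasis ℂ V j) := by
  simp only [hermTrace, dualFrame, map_sum, map_smul, smul_eq_mul, LinearMap.sum_apply,
    LinearMap.smul_apply]
  exact Finset.sum_comm

/-- The trace is invariant under linear isomorphisms. -/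
lemma hermTrace_pullback {G : V →ₗ[ℂ] V →ₗ⋆[ℂ] ℂ} (hG : IsPosHermitian G)
    (B : V →ₗ[ℂ] V →ₗ⋆[ℂ] ℂ) (L : V ≃ₗ[ℂ] V) :
    hermTrace (fun u v => G (L u) (L v)) (fun u v => B (L u) (L v)) =
      hermTrace (fun u v => G u v) (fun u v => B u v) := by
  have hP := hG.pullForm L
  have h1 := hermTrace_eq_sum_form (fun u v => pullForm G (L : V →ₗ[ℂ] V) u v)
    (pullForm B (L : V →ₗ[ℂ] V))
  simp only [pullForm_apply, LinearEquiv.coe_coe] at h1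
  rw [h1, hermTrace_eq_sum_form]
  have hd := hP.isDualPair
  -- The image under `L` of a dual pair for the pulled-back form is a dual pair for `G`, so
  -- independence of the frame applies.
  refine IsDualPair.sum_eq hG hG.isDualPair
    (e' := fun j => L (dualFrame (fun u v => G (L u) (L v)) j))
    (c' := fun j => L (Module.finBasis ℂ V j)) ⟨fun w => ?_, fun y => ?_⟩ B
  · have := congrArg L (hd.left (L.symm w))
    simpa using this
  · have := congrArg L (hd.right (L.symm y))
    simpa using this

end Trace

/-! ### Hermitian metrics in local coordinates -/

section LocalMetric

variable {V : Type*} [NormedAddCommGroup V] [NormedSpace ℂ V]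

/-- A smooth Hermitian metric on an open set `U` of a complex vector space. -/
structure LocalMetric (U : Set V) (H : V → V →ₗ[ℂ] V →ₗ⋆[ℂ] ℂ) : Prop where
  isOpen : IsOpen U
  posHermitian : ∀ z ∈ U, IsPosHermitian (H z)
  smooth : ∀ u v, ContDiffOn ℝ ∞ (fun z => H z u v) U

lemma smooth_det {ι : Type*} [Fintype ι] [DecidableEq ι] {M : V → Matrix ι ι ℂ} {U : Set V}
    (hM : ∀ i j, ContDiffOn ℝ ∞ (fun z => M z i j) U) :
    ContDiffOn ℝ ∞ (fun z => (M z).det) U := by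
  simp only [Matrix.det_apply]
  exact ContDiffOn.sum fun σ _ => (contDiffOn_prod fun i _ => hM _ _).const_smul _

lemma smooth_adjugate {ι : Type*} [Fintype ι] [DecidableEq ι] {M : V → Matrix ι ι ℂ} {U : Set V}
    (hM : ∀ i j, ContDiffOn ℝ ∞ (fun z => M z i j) U) (i j : ι) :
    ContDiffOn ℝ ∞ (fun z => (M z).adjugate i j) U := by
  simp only [Matrix.adjugate_apply]
  refine smooth_det fun k l => ?_
  by_cases hk : k = j
  · subst hk
    simpa using contDiffOn_const
  · simpa [Matrix.updateRow_ne hk] using hM k l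

/-- `∂_u` is complex linear in `u`. -/
lemma dz_smul_left {W : Type*} [NormedAddCommGroup W] [NormedSpace ℂ W] (c : ℂ) (u : V)
    (s : V → W) (z : V) : dz (c • u) s z = c • dz u s z := by
  have h (r : ℝ) (w : V) : fderiv ℝ s z ((r : ℂ) • w) = (r : ℂ) • fderiv ℝ s z w := by
    rw [Complex.coe_smul, map_smul, Complex.coe_smul]
  have hc (w : V) : fderiv ℝ s z (c • w)
      = (c.re : ℂ) • fderiv ℝ s z w + (c.im : ℂ) • fderiv ℝ s z (Complex.I • w) := by
    conv_lhs => rw [← Complex.re_add_im c, add_smul, mul_smul, map_add, h, h]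
  rw [dz, dz, smul_comm Complex.I c u, hc, hc, smul_smul Complex.I, Complex.I_mul_I]
  conv_rhs => rw [← Complex.re_add_im c]
  simp only [neg_smul, one_smul, map_neg]
  have : (Complex.I * Complex.I) = -1 := Complex.I_mul_I
  match_scalars
  · ring
  · linear_combination ((c.im : ℂ) / 2) * this

lemma dz_add_left {W : Type*} [NormedAddCommGroup W] [NormedSpace ℂ W] (u u' : V)
    (s : V → W) (z : V) : dz (u + u') s z = dz u s z + dz u' s z := by
  simp only [dz, smul_add, map_add]
  module

/-- The derivative `∂_u L` of a family of linear maps. -/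
def dzLin {W W' : Type*} [NormedAddCommGroup W] [NormedSpace ℂ W] [NormedAddCommGroup W']
    [NormedSpace ℂ W'] {U : Set V} (hU : IsOpen U) {L : V → W →ₗ[ℂ] W'}
    (hL : ∀ w, ContDiffOn ℝ ∞ (fun z => L z w) U) {z : V} (hz : z ∈ U) (u : V) : W →ₗ[ℂ] W' where
  toFun w := dz u (fun z => L z w) z
  map_add' w w' := by
    simp only [map_add]
    exact dz_add (smooth_differentiableAt hU (hL w) hz) (smooth_differentiableAt hU (hL w') hz) u
  map_smul' c w := by
    simp only [map_smul, dz, RingHom.id_apply]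
    rw [fderiv_fun_const_smul (smooth_differentiableAt hU (hL w) hz)]
    simp only [smul_apply]
    module

/-- The derivative `∂_{ū} L` of a family of linear maps. -/
def dzbarLin {W W' : Type*} [NormedAddCommGroup W] [NormedSpace ℂ W] [NormedAddCommGroup W']
    [NormedSpace ℂ W'] {U : Set V} (hU : IsOpen U) {L : V → W →ₗ[ℂ] W'}
    (hL : ∀ w, ContDiffOn ℝ ∞ (fun z => L z w) U) {z : V} (hz : z ∈ U) (u : V) : W →ₗ[ℂ] W' where
  toFun w := dzbar u (fun z => L z w) z
  map_add' w w' := by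
    simp only [map_add]
    exact dzbar_add (smooth_differentiableAt hU (hL w) hz)
      (smooth_differentiableAt hU (hL w') hz) u
  map_smul' c w := by
    simp only [map_smul, dzbar, RingHom.id_apply]
    rw [fderiv_fun_const_smul (smooth_differentiableAt hU (hL w) hz)]
    simp only [smul_apply]
    module

variable [FiniteDimensional ℂ V] {U : Set V} {H : V → V →ₗ[ℂ] V →ₗ⋆[ℂ] ℂ}

/-- Cramer's rule: the inverse is the adjugate divided by a nonvanishing determinant, and both are
polynomial in the entries. -/
lemma LocalMetric.smooth_gInv (h : LocalMetric U H) (i j : Fin (Module.finrank ℂ V)) :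
    ContDiffOn ℝ ∞ (fun z => gInv (fun u v => H z u v) i j) U := by
  simp only [gInv, Matrix.inv_def, Ring.inverse_eq_inv', Matrix.smul_apply, smul_eq_mul]
  refine ContDiffOn.mul (ContDiffOn.inv (smooth_det fun _ _ => h.smooth _ _) fun z hz =>
    (h.posHermitian z hz).gram_det_ne_zero) (smooth_adjugate (fun _ _ => h.smooth _ _) _ _)

lemma LocalMetric.smooth_dualFrame (h : LocalMetric U H) (j : Fin (Module.finrank ℂ V)) :
    ContDiffOn ℝ ∞ (fun z => dualFrame (fun u v => H z u v) j) U :=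
  ContDiffOn.sum fun i _ => (h.smooth_gInv i j).smul contDiffOn_const

variable (H) in
/-- The Chern connection form `Γ(u, v) = ∇_u v` on constant fields, as a bilinear map. -/
def christoffel (z : V) : V →ₗ[ℂ] V →ₗ[ℂ] V :=
  -- Expanding `v` in the basis makes linearity in `v` hold at every point, without any
  -- differentiability of `H`.
  LinearMap.mk₂ ℂ (fun u v => ∑ l, (∑ m, (Module.finBasis ℂ V).repr v m *
      dz u (fun z' => H z' (Module.finBasis ℂ V m) (Module.finBasis ℂ V l)) z) •
      dualFrame (fun u v => H z u v) l)
    (fun u u' v => by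
      simp only [dz_add_left, mul_add, Finset.sum_add_distrib, add_smul])
    (fun c u v => by
      simp only [dz_smul_left, smul_eq_mul, Finset.smul_sum, smul_smul, Finset.mul_sum]
      simp only [mul_left_comm])
    (fun u v v' => by
      simp only [map_add, Finsupp.add_apply, add_mul, Finset.sum_add_distrib, add_smul])
    (fun c u v => by
      simp only [map_smul, Finsupp.smul_apply, smul_eq_mul, Finset.smul_sum, smul_smul,
        Finset.mul_sum, mul_assoc])

/-- Where `H` is smooth, `∂_u H(·, w)` is linear; this undoes the basis expansion in `christoffel`.
-/
lemma LocalMetric.dz_expand (h : LocalMetric U H) {z : V} (hz : z ∈ U) (u v w : V) :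
    dz u (fun z' => H z' v w) z = ∑ m, (Module.finBasis ℂ V).repr v m *
      dz u (fun z' => H z' (Module.finBasis ℂ V m) w) z := by
  have h1 := congrArg (dzLin h.isOpen (L := fun z => (H z).flip w) (fun v => h.smooth v w) hz u)
    ((Module.finBasis ℂ V).sum_repr v)
  rw [map_sum] at h1
  simp only [map_smul] at h1
  exact h1.symm

lemma LocalMetric.chernD10_const (h : LocalMetric U H) {z : V} (hz : z ∈ U) (u v : V) :
    chernD10 (fun z u v => H z u v) u (fun _ => v) z = christoffel H z u v := by
  simp only [chernD10, dz_const, zero_add, christoffel, LinearMap.mk₂_apply, dualFrame]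
  rw [Finset.sum_comm]
  refine Finset.sum_congr rfl fun l _ => ?_
  rw [← h.dz_expand hz, Finset.smul_sum]
  simp only [smul_smul, mul_comm]

lemma LocalMetric.smooth_christoffel (h : LocalMetric U H) (u v : V) :
    ContDiffOn ℝ ∞ (fun z => christoffel H z u v) U := by
  simp only [christoffel, LinearMap.mk₂_apply]
  exact ContDiffOn.sum fun l _ => (ContDiffOn.sum fun m _ =>
    contDiffOn_const.mul (smooth_dz h.isOpen (h.smooth _ _) u)).smul (h.smooth_dualFrame l)

omit [FiniteDimensional ℂ V] in
lemma LocalMetric.conj_dz (h : LocalMetric U H) {z : V} (hz : z ∈ U) (u v w : V) :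
    dzbar u (fun z' => H z' v w) z = conj (dz u (fun z' => H z' w v) z) := by
  rw [← dzbar_conj]
  refine dzbar_congr ?_ u
  filter_upwards [h.isOpen.mem_nhds hz] with z' hz'
  exact (h.posHermitian z' hz').conj_symm w v

/-- The defining property of the Chern connection. -/
lemma LocalMetric.form_christoffel (h : LocalMetric U H) {z : V} (hz : z ∈ U) (u v w : V) :
    H z (christoffel H z u v) w = dz u (fun z' => H z' v w) z := by
  set b := Module.finBasis ℂ V
  have key (k) : H z (christoffel H z u v) (b k) = dz u (fun z' => H z' v (b k)) z := by
    simp only [christoffel, LinearMap.mk₂_apply, ← h.dz_expand hz, map_sum, map_smul,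
      LinearMap.sum_apply, LinearMap.smul_apply, b, (h.posHermitian z hz).dualFrame_apply]
    simp
  -- The identity is known for basis vectors `w`. Writing the conjugate-linear dependence on `w` as
  -- the conjugate of the linear map `dzbarLin` lets it be extended by linearity.
  have h1 : dz u (fun z' => H z' v w) z = conj (dzbarLin h.isOpen
      (L := fun z => (H z).flip v) (fun w => h.smooth w v) hz u w) := by
    rw [← Complex.conj_conj (dz u (fun z' => H z' v w) z), ← h.conj_dz hz]
    rfl
  have h2 (k) : dz u (fun z' => H z' v (b k)) z = conj (dzbarLin h.isOpen
      (L := fun z => (H z).flip v) (fun w => h.smooth w v) hz u (b k)) := by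
    rw [← Complex.conj_conj (dz u (fun z' => H z' v (b k)) z), ← h.conj_dz hz]
    rfl
  rw [h1, ← b.sum_repr w]
  simp only [map_sum, LinearMap.map_smulₛₗ, key, h2]
  simp

lemma LocalMetric.form_christoffel_right (h : LocalMetric U H) {z : V} (hz : z ∈ U)
    (u v w : V) : H z v (christoffel H z u w) = dzbar u (fun z' => H z' v w) z := by
  rw [h.conj_dz hz, ← h.form_christoffel hz]
  exact (h.posHermitian z hz).conj_symm _ _

/-- Apply `∂_u` to the constants `H(e_j, b_k) = δ_{jk}`: since `∂_{ū} b_k = 0`, the dual frame is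
parallel for the (1,0)-part of the Chern connection. -/
lemma LocalMetric.dz_dualFrame (h : LocalMetric U H) {z : V} (hz : z ∈ U) (u : V)
    (j : Fin (Module.finrank ℂ V)) :
    dz u (fun z => dualFrame (fun u v => H z u v) j) z =
      - christoffel H z u (dualFrame (fun u v => H z u v) j) := by
  refine (h.posHermitian z hz).ext_basis fun k => ?_
  have h1 := dz_form h.isOpen h.smooth (h.smooth_dualFrame j)
    (contDiffOn_const (c := Module.finBasis ℂ V k)) hz u
  have h2 : dz u (fun z => H z (dualFrame (fun u v => H z u v) j) (Module.finBasis ℂ V k)) z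
      = 0 := by
    rw [← dz_const u (if j = k then (1 : ℂ) else 0) z]
    refine dz_congr ?_ u
    filter_upwards [h.isOpen.mem_nhds hz] with z' hz'
    exact (h.posHermitian z' hz').dualFrame_apply j k
  rw [h2, dzbar_const, map_zero, ← h.form_christoffel hz] at h1
  rw [map_neg, LinearMap.neg_apply]
  linear_combination -h1

/-- The same constants differentiated by `∂_{ū}`; now the derivative of the metric falls on the
second slot. -/
lemma LocalMetric.form_dzbar_dualFrame (h : LocalMetric U H) {z : V} (hz : z ∈ U) (u : V)
    (j k : Fin (Module.finrank ℂ V)) :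
    H z (dzbar u (fun z => dualFrame (fun u v => H z u v) j) z) (Module.finBasis ℂ V k) =
      - H z (dualFrame (fun u v => H z u v) j)
        (christoffel H z u (Module.finBasis ℂ V k)) := by
  have h1 := dzbar_form h.isOpen h.smooth (h.smooth_dualFrame j)
    (contDiffOn_const (c := Module.finBasis ℂ V k)) hz u
  have h2 : dzbar u (fun z => H z (dualFrame (fun u v => H z u v) j) (Module.finBasis ℂ V k)) z
      = 0 := by
    rw [← dzbar_const u (if j = k then (1 : ℂ) else 0) z]
    refine dzbar_congr ?_ u
    filter_upwards [h.isOpen.mem_nhds hz] with z' hz'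
    exact (h.posHermitian z' hz').dualFrame_apply j k
  rw [h2, dz_const, map_zero, ← h.form_christoffel_right hz] at h1
  linear_combination -h1

/-- The derivative `∂_{v̄} Γ(u, ·)`, which is minus the curvature operator. -/
def LocalMetric.dzbarChristoffel (h : LocalMetric U H) {z : V} (hz : z ∈ U) (u v : V) :
    V →ₗ[ℂ] V :=
  dzbarLin h.isOpen (L := fun z => christoffel H z u) (fun w => h.smooth_christoffel u w) hz v

/-- A constant field is holomorphic, so only the `∂_{v̄}`-derivative of the connection form survives
in the commutator. -/
lemma LocalMetric.localChernCurvature_eq (h : LocalMetric U H) {z : V} (hz : z ∈ U)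
    (u v w y : V) :
    localChernCurvature (fun z u v => H z u v) z u v w y =
      - H z (h.dzbarChristoffel hz u v w) y := by
  have h0 : chernD01 v (fun _ : V => w) = fun _ => 0 := funext fun z => dzbar_const v w z
  have h1 : chernD10 (fun z u v => H z u v) u (fun _ => (0 : V)) z = 0 := by
    simp [chernD10]
  have h2 : chernD01 v (chernD10 (fun z u v => H z u v) u fun _ => w) z =
      h.dzbarChristoffel hz u v w := by
    refine dzbar_congr ?_ v
    filter_upwards [h.isOpen.mem_nhds hz] with z' hz'
    exact h.chernD10_const hz' u w
  rw [localChernCurvature, h0, h1, h2, zero_sub, map_neg, LinearMap.neg_apply]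

end LocalMetric

/-! ### The Bochner formula in local coordinates -/

section LocalBochner

variable {E : Type*} [NormedAddCommGroup E] [NormedSpace ℂ E]
  {F : Type*} [NormedAddCommGroup F] [NormedSpace ℂ F]

/-- A holomorphic map between open sets. -/
structure LocalMap (U : Set E) (U' : Set F) (f : E → F) : Prop where
  mapsTo : Set.MapsTo f U U'
  holomorphic : ContDiffOn ℂ ω f U

section LocalMap

variable {U : Set E} {U' : Set F} {f : E → F}

lemma LocalMap.differentiableAt (hf : LocalMap U U' f) (hU : IsOpen U) {z : E} (hz : z ∈ U) :
    DifferentiableAt ℂ f z :=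
  (hf.holomorphic.contDiffAt (hU.mem_nhds hz)).differentiableAt (by simp)

lemma LocalMap.contDiffOn_fderiv (hf : LocalMap U U' f) (hU : IsOpen U) :
    ContDiffOn ℂ ω (fderiv ℂ f) U :=
  hf.holomorphic.fderiv_of_isOpen hU (by simp)

lemma LocalMap.contDiffOn_fderiv_fderiv (hf : LocalMap U U' f) (hU : IsOpen U) :
    ContDiffOn ℂ ω (fderiv ℂ (fderiv ℂ f)) U :=
  (hf.contDiffOn_fderiv hU).fderiv_of_isOpen hU (by simp)

lemma LocalMap.smooth (hf : LocalMap U U' f) : ContDiffOn ℝ ∞ f U :=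
  (hf.holomorphic.restrict_scalars ℝ).of_le (by simp)

lemma LocalMap.smooth_fderiv (hf : LocalMap U U' f) (hU : IsOpen U) (w : E) :
    ContDiffOn ℝ ∞ (fun z => fderiv ℂ f z w) U :=
  (((hf.contDiffOn_fderiv hU).clm_apply contDiffOn_const).restrict_scalars ℝ).of_le (by simp)

lemma LocalMap.smooth_fderiv_fderiv (hf : LocalMap U U' f) (hU : IsOpen U) (u w : E) :
    ContDiffOn ℝ ∞ (fun z => fderiv ℂ (fderiv ℂ f) z u w) U :=
  ((((hf.contDiffOn_fderiv_fderiv hU).clm_apply contDiffOn_const).clm_apply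
    contDiffOn_const).restrict_scalars ℝ).of_le (by simp)

lemma LocalMap.hasFDerivAt_fderiv (hf : LocalMap U U' f) (hU : IsOpen U) {z : E} (hz : z ∈ U)
    (w : E) : HasFDerivAt (fun z => fderiv ℂ f z w) ((fderiv ℂ (fderiv ℂ f) z).flip w) z := by
  have h2 : DifferentiableAt ℂ (fderiv ℂ f) z :=
    ((hf.contDiffOn_fderiv hU).contDiffAt (hU.mem_nhds hz)).differentiableAt (by simp)
  simpa using h2.hasFDerivAt.clm_apply (hasFDerivAt_const w z)

lemma LocalMap.dz_fderiv (hf : LocalMap U U' f) (hU : IsOpen U) {z : E} (hz : z ∈ U) (u w : E) :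
    dz u (fun z => fderiv ℂ f z w) z = fderiv ℂ (fderiv ℂ f) z u w := by
  have h := hf.hasFDerivAt_fderiv hU hz w
  rw [dz_of_holomorphic h.differentiableAt, h.fderiv]; rfl

lemma LocalMap.dzbar_fderiv (hf : LocalMap U U' f) (hU : IsOpen U) {z : E} (hz : z ∈ U)
    (u w : E) : dzbar u (fun z => fderiv ℂ f z w) z = 0 :=
  dzbar_of_holomorphic (hf.hasFDerivAt_fderiv hU hz w).differentiableAt u

lemma LocalMap.dzbar_fderiv_fderiv (hf : LocalMap U U' f) (hU : IsOpen U) {z : E} (hz : z ∈ U)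
    (u v w : E) : dzbar v (fun z => fderiv ℂ (fderiv ℂ f) z u w) z = 0 :=
  dzbar_of_holomorphic (((((hf.contDiffOn_fderiv_fderiv hU).clm_apply
    contDiffOn_const).clm_apply contDiffOn_const).contDiffAt (hU.mem_nhds hz)).differentiableAt
      (by simp)) v

lemma LocalMap.fderiv_fderiv_symm (hf : LocalMap U U' f) (hU : IsOpen U) {z : E} (hz : z ∈ U)
    (u w : E) : fderiv ℂ (fderiv ℂ f) z u w = fderiv ℂ (fderiv ℂ f) z w u :=
  (hf.holomorphic.contDiffAt (hU.mem_nhds hz)).isSymmSndFDerivAt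
    (by simp) u w

end LocalMap

variable [FiniteDimensional ℂ E] [FiniteDimensional ℂ F]

/-- The Chern Hessian of `f` in local coordinates. -/
def chernHessian (H : E → E →ₗ[ℂ] E →ₗ⋆[ℂ] ℂ) (K : F → F →ₗ[ℂ] F →ₗ⋆[ℂ] ℂ) (f : E → F)
    (z u : E) : E →ₗ[ℂ] F :=
  (fderiv ℂ (fderiv ℂ f) z u : E →ₗ[ℂ] F)
    + (christoffel K (f z) (fderiv ℂ f z u)).comp (fderiv ℂ f z : E →ₗ[ℂ] F)
    - (fderiv ℂ f z : E →ₗ[ℂ] F).comp (christoffel H z u)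

lemma chernHessian_apply (H : E → E →ₗ[ℂ] E →ₗ⋆[ℂ] ℂ) (K : F → F →ₗ[ℂ] F →ₗ⋆[ℂ] ℂ)
    (f : E → F) (z u w : E) :
    chernHessian H K f z u w = fderiv ℂ (fderiv ℂ f) z u w
      + christoffel K (f z) (fderiv ℂ f z u) (fderiv ℂ f z w)
      - fderiv ℂ f z (christoffel H z u w) := rfl

/-- The energy density of `f` in local coordinates. -/
def localEnergy (H : E → E →ₗ[ℂ] E →ₗ⋆[ℂ] ℂ) (K : F → F →ₗ[ℂ] F →ₗ⋆[ℂ] ℂ) (f : E → F)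
    (z : E) : ℂ :=
  hermTrace (fun u v => H z u v) fun w y => K (f z) (fderiv ℂ f z w) (fderiv ℂ f z y)

variable {U : Set E} {U' : Set F} {f : E → F} {H : E → E →ₗ[ℂ] E →ₗ⋆[ℂ] ℂ}
  {K : F → F →ₗ[ℂ] F →ₗ⋆[ℂ] ℂ}

-- All dependence on the inverse metric is carried by the dual frame, while the vectors in the
-- conjugate slot stay constant.
omit [FiniteDimensional ℂ F] in
lemma localEnergy_eq_sum (z : E) : localEnergy H K f z =
    ∑ j, K (f z) (fderiv ℂ f z (dualFrame (fun u v => H z u v) j))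
      (fderiv ℂ f z (Module.finBasis ℂ E j)) :=
  hermTrace_eq_sum_form (fun u v => H z u v)
    (pullForm (K (f z)) (fderiv ℂ f z : E →ₗ[ℂ] F))

variable (hH : LocalMetric U H) (hK : LocalMetric U' K) (hf : LocalMap U U' f)
include hH hK hf

omit hH [FiniteDimensional ℂ E] [FiniteDimensional ℂ F] in
lemma smooth_comp_form (a b : F) : ContDiffOn ℝ ∞ (fun z => K (f z) a b) U :=
  (hK.smooth a b).comp hf.smooth hf.mapsTo

omit hH [FiniteDimensional ℂ E] in
lemma smooth_comp_christoffel (a b : F) :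
    ContDiffOn ℝ ∞ (fun z => christoffel K (f z) a b) U :=
  (hK.smooth_christoffel a b).comp hf.smooth hf.mapsTo

omit [FiniteDimensional ℂ E] in
lemma smooth_comp_christoffel_fderiv (u : E) (b : F) :
    ContDiffOn ℝ ∞ (fun z => christoffel K (f z) (fderiv ℂ f z u) b) U :=
  smooth_lin (L := fun z => (christoffel K (f z)).flip b)
    (fun a => smooth_comp_christoffel hK hf a b) (hf.smooth_fderiv hH.isOpen u)

lemma smooth_chernHessian (u w : E) : ContDiffOn ℝ ∞ (fun z => chernHessian H K f z u w) U := by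
  simp only [chernHessian_apply]
  refine ((hf.smooth_fderiv_fderiv hH.isOpen u w).add ?_).sub ?_
  · exact smooth_lin (fun b => smooth_comp_christoffel_fderiv hH hK hf u b)
      (hf.smooth_fderiv hH.isOpen w)
  · exact smooth_lin (L := fun z => (fderiv ℂ f z : E →ₗ[ℂ] F))
      (fun b => hf.smooth_fderiv hH.isOpen b) (hH.smooth_christoffel u w)

omit hK [FiniteDimensional ℂ F] in
lemma smooth_fderiv_dualFrame (j : Fin (Module.finrank ℂ E)) :
    ContDiffOn ℝ ∞ (fun z => fderiv ℂ f z (dualFrame (fun u v => H z u v) j)) U :=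
  smooth_lin (L := fun z => (fderiv ℂ f z : E →ₗ[ℂ] F))
    (fun b => hf.smooth_fderiv hH.isOpen b) (hH.smooth_dualFrame j)

lemma smooth_localEnergy : ContDiffOn ℝ ∞ (localEnergy H K f) U := by
  have : localEnergy H K f = _ := funext localEnergy_eq_sum
  rw [this]
  exact ContDiffOn.sum fun j _ => smooth_form (smooth_comp_form hK hf)
    (smooth_fderiv_dualFrame hH hf j) (hf.smooth_fderiv hH.isOpen _)

omit [FiniteDimensional ℂ E] in
/-- `∂_u (h(a, b))` for constant fields along `f`. -/
lemma dz_comp_form {z : E} (hz : z ∈ U) (u : E) (a b : F) :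
    dz u (fun z => K (f z) a b) z = K (f z) (christoffel K (f z) (fderiv ℂ f z u) a) b := by
  rw [hK.form_christoffel (hf.mapsTo hz)]
  exact dz_comp_holomorphic (hf.differentiableAt hH.isOpen hz)
    (smooth_differentiableAt hK.isOpen (hK.smooth a b) (hf.mapsTo hz)) u

omit [FiniteDimensional ℂ E] in
lemma dzbar_comp_form {z : E} (hz : z ∈ U) (u : E) (a b : F) :
    dzbar u (fun z => K (f z) a b) z = K (f z) a (christoffel K (f z) (fderiv ℂ f z u) b) := by
  rw [hK.form_christoffel_right (hf.mapsTo hz)]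
  exact dzbar_comp_holomorphic (hf.differentiableAt hH.isOpen hz)
    (smooth_differentiableAt hK.isOpen (hK.smooth a b) (hf.mapsTo hz)) u

/-- The derivatives of the target metric, of `df` and of the dual frame supply the three terms of
the Chern Hessian. The conjugate slot contributes nothing because `df` is holomorphic. -/
lemma dz_localEnergy {z : E} (hz : z ∈ U) (u : E) :
    dz u (localEnergy H K f) z = ∑ j,
      K (f z) (chernHessian H K f z u (dualFrame (fun u v => H z u v) j))
        (fderiv ℂ f z (Module.finBasis ℂ E j)) := by
  have : localEnergy H K f = _ := funext localEnergy_eq_sum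
  rw [this, dz_sum fun j => smooth_differentiableAt hH.isOpen (smooth_form
    (smooth_comp_form hK hf) (smooth_fderiv_dualFrame hH hf j)
    (hf.smooth_fderiv hH.isOpen _)) hz]
  refine Finset.sum_congr rfl fun j _ => ?_
  have h1 := dz_lin (L := fun z => (fderiv ℂ f z : E →ₗ[ℂ] F)) hH.isOpen
    (fun b => hf.smooth_fderiv hH.isOpen b) (hH.smooth_dualFrame j) hz u
  simp only [ContinuousLinearMap.coe_coe] at h1
  rw [dz_form hH.isOpen (smooth_comp_form hK hf) (smooth_fderiv_dualFrame hH hf j)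
    (hf.smooth_fderiv hH.isOpen _) hz, dz_comp_form hH hK hf hz, hf.dzbar_fderiv hH.isOpen hz,
    h1, hf.dz_fderiv hH.isOpen hz, hH.dz_dualFrame hz, chernHessian_apply, map_zero, add_zero,
    ← LinearMap.add_apply, ← map_add, map_neg]
  congr 2
  abel

omit [FiniteDimensional ℂ E] in
lemma dzbar_comp_christoffel {z : E} (hz : z ∈ U) (u v : E) (b : F) :
    dzbar v (fun z => christoffel K (f z) (fderiv ℂ f z u) b) z =
      hK.dzbarChristoffel (hf.mapsTo hz) (fderiv ℂ f z u) (fderiv ℂ f z v) b := by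
  have h1 := dzbar_lin (L := fun z => (christoffel K (f z)).flip b) hH.isOpen
    (fun a => smooth_comp_christoffel hK hf a b) (hf.smooth_fderiv hH.isOpen u) hz v
  simp only [LinearMap.flip_apply] at h1
  rw [h1, hf.dzbar_fderiv hH.isOpen hz, map_zero, LinearMap.zero_apply, add_zero]
  exact dzbar_comp_holomorphic (hf.differentiableAt hH.isOpen hz)
    (smooth_differentiableAt hK.isOpen (hK.smooth_christoffel _ b) (hf.mapsTo hz)) v

/-- Everything built from `f` alone is annihilated by `∂_{v̄}`, so only the two connection forms are
differentiated; each yields minus a curvature operator. -/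
lemma dzbar_chernHessian {z : E} (hz : z ∈ U) (u v w : E) :
    dzbar v (fun z => chernHessian H K f z u w) z =
      hK.dzbarChristoffel (hf.mapsTo hz) (fderiv ℂ f z u) (fderiv ℂ f z v) (fderiv ℂ f z w)
        - fderiv ℂ f z (hH.dzbarChristoffel hz u v w) := by
  have s1 := hf.smooth_fderiv_fderiv hH.isOpen u w
  have s2 : ContDiffOn ℝ ∞ (fun z => christoffel K (f z) (fderiv ℂ f z u) (fderiv ℂ f z w)) U :=
    smooth_lin (fun b => smooth_comp_christoffel_fderiv hH hK hf u b)
      (hf.smooth_fderiv hH.isOpen w)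
  have s3 : ContDiffOn ℝ ∞ (fun z => fderiv ℂ f z (christoffel H z u w)) U :=
    smooth_lin (L := fun z => (fderiv ℂ f z : E →ₗ[ℂ] F))
      (fun b => hf.smooth_fderiv hH.isOpen b) (hH.smooth_christoffel u w)
  simp only [chernHessian_apply]
  rw [dzbar_sub (smooth_differentiableAt hH.isOpen (s1.add s2) hz)
      (smooth_differentiableAt hH.isOpen s3 hz),
    dzbar_add (smooth_differentiableAt hH.isOpen s1 hz)
      (smooth_differentiableAt hH.isOpen s2 hz), hf.dzbar_fderiv_fderiv hH.isOpen hz, zero_add]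
  congr 1
  · rw [dzbar_lin (L := fun z => christoffel K (f z) (fderiv ℂ f z u)) hH.isOpen
      (fun b => smooth_comp_christoffel_fderiv hH hK hf u b)
      (hf.smooth_fderiv hH.isOpen w) hz, hf.dzbar_fderiv hH.isOpen hz, map_zero, add_zero]
    exact dzbar_comp_christoffel hH hK hf hz u v _
  · have h3 := dzbar_lin (L := fun z => (fderiv ℂ f z : E →ₗ[ℂ] F)) hH.isOpen
      (fun b => hf.smooth_fderiv hH.isOpen b) (hH.smooth_christoffel u w) hz v
    simp only [ContinuousLinearMap.coe_coe] at h3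
    rw [h3, hf.dzbar_fderiv hH.isOpen hz, zero_add]
    rfl

/-- The second derivatives of the energy density. -/
lemma dzbar_dz_localEnergy {z : E} (hz : z ∈ U) (u v : E) :
    dzbar v (dz u (localEnergy H K f)) z =
      ∑ j, K (f z) (chernHessian H K f z u (dualFrame (fun u v => H z u v) j))
          (chernHessian H K f z v (Module.finBasis ℂ E j))
        + ∑ j, K (f z) (hK.dzbarChristoffel (hf.mapsTo hz) (fderiv ℂ f z u) (fderiv ℂ f z v)
          (fderiv ℂ f z (dualFrame (fun u v => H z u v) j)))
          (fderiv ℂ f z (Module.finBasis ℂ E j))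
        - ∑ j, K (f z) (fderiv ℂ f z (hH.dzbarChristoffel hz u v
          (dualFrame (fun u v => H z u v) j))) (fderiv ℂ f z (Module.finBasis ℂ E j)) := by
  have hloc : dzbar v (dz u (localEnergy H K f)) z = dzbar v (fun z => ∑ j,
      K (f z) (chernHessian H K f z u (dualFrame (fun u v => H z u v) j))
        (fderiv ℂ f z (Module.finBasis ℂ E j))) z := by
    refine dzbar_congr ?_ v
    filter_upwards [hH.isOpen.mem_nhds hz] with z' hz'
    exact dz_localEnergy hH hK hf hz' u
  have s (j) : ContDiffOn ℝ ∞
      (fun z => chernHessian H K f z u (dualFrame (fun u v => H z u v) j)) U :=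
    smooth_lin (fun w => smooth_chernHessian hH hK hf u w) (hH.smooth_dualFrame j)
  -- In the conjugate slot the product rule produces only the part `Γ'(df v, df b_j) + ∂∂f(v, b_j)`
  -- of the Hessian. The missing `-df Γ(v, b_j)` must come from the derivative of the dual frame in
  -- the last summand.
  have hterm (j) : dzbar v (fun z =>
      K (f z) (chernHessian H K f z u (dualFrame (fun u v => H z u v) j))
        (fderiv ℂ f z (Module.finBasis ℂ E j))) z =
      K (f z) (chernHessian H K f z u (dualFrame (fun u v => H z u v) j))
          (christoffel K (f z) (fderiv ℂ f z v) (fderiv ℂ f z (Module.finBasis ℂ E j))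
            + fderiv ℂ (fderiv ℂ f) z v (Module.finBasis ℂ E j))
        + K (f z) (hK.dzbarChristoffel (hf.mapsTo hz) (fderiv ℂ f z u) (fderiv ℂ f z v)
            (fderiv ℂ f z (dualFrame (fun u v => H z u v) j)))
          (fderiv ℂ f z (Module.finBasis ℂ E j))
        - K (f z) (fderiv ℂ f z (hH.dzbarChristoffel hz u v
          (dualFrame (fun u v => H z u v) j))) (fderiv ℂ f z (Module.finBasis ℂ E j))
        + K (f z) (chernHessian H K f z u
            (dzbar v (fun z => dualFrame (fun u v => H z u v) j) z))
          (fderiv ℂ f z (Module.finBasis ℂ E j)) := by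
    rw [dzbar_form hH.isOpen (smooth_comp_form hK hf) (s j) (hf.smooth_fderiv hH.isOpen _) hz,
      dzbar_comp_form hH hK hf hz, hf.dz_fderiv hH.isOpen hz,
      dzbar_lin (L := fun z => chernHessian H K f z u) hH.isOpen
        (fun w => smooth_chernHessian hH hK hf u w) (hH.smooth_dualFrame j) hz,
      dzbar_chernHessian hH hK hf hz]
    simp only [map_add, map_sub, LinearMap.add_apply, LinearMap.sub_apply]
    ring
  -- By duality, `∑ ∂_{v̄} e_j ⊗ conj(b_j) = -∑ e_k ⊗ conj(Γ(v, b_k))`: expand the left vectors in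
  -- the dual frame, exchange the sums, and resum in the constant basis.
  have hsum : ∑ j, K (f z) (chernHessian H K f z u
            (dzbar v (fun z => dualFrame (fun u v => H z u v) j) z))
          (fderiv ℂ f z (Module.finBasis ℂ E j)) =
      - ∑ k, K (f z) (chernHessian H K f z u (dualFrame (fun u v => H z u v) k))
          (fderiv ℂ f z (christoffel H z v (Module.finBasis ℂ E k))) := by
    have hd := (hH.posHermitian z hz).isDualPair
    calc _ = ∑ j, ∑ k, - (H z (dualFrame (fun u v => H z u v) j)
            (christoffel H z v (Module.finBasis ℂ E k)) *
          K (f z) (chernHessian H K f z u (dualFrame (fun u v => H z u v) k))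
            (fderiv ℂ f z (Module.finBasis ℂ E j))) := by
          refine Finset.sum_congr rfl fun j _ => ?_
          conv_lhs => rw [← hd.left (dzbar v (fun z => dualFrame (fun u v => H z u v) j) z)]
          simp only [map_sum, map_smul, LinearMap.sum_apply, LinearMap.smul_apply, smul_eq_mul,
            hH.form_dzbar_dualFrame hz, neg_mul]
      _ = ∑ k, ∑ j, - (H z (dualFrame (fun u v => H z u v) j)
            (christoffel H z v (Module.finBasis ℂ E k)) *
          K (f z) (chernHessian H K f z u (dualFrame (fun u v => H z u v) k))
            (fderiv ℂ f z (Module.finBasis ℂ E j))) := Finset.sum_comm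
      _ = _ := by
          rw [← Finset.sum_neg_distrib]
          refine Finset.sum_congr rfl fun k _ => ?_
          conv_rhs => rw [← hd.right (christoffel H z v (Module.finBasis ℂ E k))]
          simp only [map_sum, map_smul, LinearMap.map_smulₛₗ, smul_eq_mul,
            ← (hH.posHermitian z hz).conj_symm, Finset.sum_neg_distrib]
  rw [hloc, dzbar_sum fun j => smooth_differentiableAt hH.isOpen (smooth_form
    (smooth_comp_form hK hf) (s j) (hf.smooth_fderiv hH.isOpen _)) hz]
  simp only [hterm, Finset.sum_add_distrib, Finset.sum_sub_distrib, hsum]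
  have hS (j) : chernHessian H K f z v (Module.finBasis ℂ E j) = _ :=
    chernHessian_apply H K f z v (Module.finBasis ℂ E j)
  simp only [hS, map_add, map_sub, Finset.sum_add_distrib, Finset.sum_sub_distrib]
  ring

end LocalBochner

/-! ### Trace identities and the traced Bochner formula -/

section LocalFormula

variable {E : Type*} [NormedAddCommGroup E] [NormedSpace ℂ E] [FiniteDimensional ℂ E]
  {F : Type*} [NormedAddCommGroup F] [NormedSpace ℂ F]

lemma hermTrace_add (G B B' : E → E → ℂ) :
    hermTrace G (fun u v => B u v + B' u v) = hermTrace G B + hermTrace G B' := by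
  simp only [hermTrace, mul_add, Finset.sum_add_distrib]

lemma hermTrace_sub (G B B' : E → E → ℂ) :
    hermTrace G (fun u v => B u v - B' u v) = hermTrace G B - hermTrace G B' := by
  simp only [hermTrace, mul_sub, Finset.sum_sub_distrib]

lemma hermTrace_mul_left (G B : E → E → ℂ) (c : ℂ) :
    hermTrace G (fun u v => c * B u v) = c * hermTrace G B := by
  simp only [hermTrace, Finset.mul_sum]
  simp only [mul_left_comm]

lemma hermTrace_comm (G : E → E → ℂ) (B : E → E → E → E → ℂ) :
    hermTrace G (fun u v => hermTrace G fun w y => B u v w y) =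
      hermTrace G (fun w y => hermTrace G fun u v => B u v w y) := by
  simp only [hermTrace, Finset.mul_sum]
  calc _ = ∑ i, ∑ k, ∑ j, ∑ l, gInv G i j * (gInv G k l * B (Module.finBasis ℂ E i)
        (Module.finBasis ℂ E j) (Module.finBasis ℂ E k) (Module.finBasis ℂ E l)) :=
        Finset.sum_congr rfl fun i _ => Finset.sum_comm
    _ = ∑ k, ∑ i, ∑ l, ∑ j, gInv G i j * (gInv G k l * B (Module.finBasis ℂ E i)
        (Module.finBasis ℂ E j) (Module.finBasis ℂ E k) (Module.finBasis ℂ E l)) := by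
        rw [Finset.sum_comm]
        exact Finset.sum_congr rfl fun i _ => Finset.sum_congr rfl fun k _ => Finset.sum_comm
    _ = _ := by
        refine Finset.sum_congr rfl fun k _ => ?_
        rw [Finset.sum_comm]
        refine Finset.sum_congr rfl fun l _ => Finset.sum_congr rfl fun i _ =>
          Finset.sum_congr rfl fun j _ => ?_
        ring

/-- The norm of a tensor splits into the norms of its symmetric and antisymmetric parts. -/
lemma hermTrace_symm_add_antisymm (G : E → E → ℂ) (K : F →ₗ[ℂ] F →ₗ⋆[ℂ] ℂ) (S : E → E → F) :
    hermTrace G (fun u v => hermTrace G fun w y => K (S u w) (S v y)) =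
      hermTrace G (fun u v => hermTrace G fun w y =>
        K ((2⁻¹ : ℝ) • (S u w + S w u)) ((2⁻¹ : ℝ) • (S v y + S y v)))
      + 1 / 4 * hermTrace G (fun u v => hermTrace G fun w y =>
        K (S u w - S w u) (S v y - S y v)) := by
  have hs (a b : F) : K ((2⁻¹ : ℝ) • a) ((2⁻¹ : ℝ) • b) = 4⁻¹ * K a b := by
    rw [← Complex.coe_smul, ← Complex.coe_smul]
    simp only [map_smul, LinearMap.map_smulₛₗ, LinearMap.smul_apply, smul_eq_mul,
      Complex.conj_ofReal]
    push_cast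
    ring
  -- The cross terms of the two squares cancel, leaving half of `|S(u, w)|²` plus half of `|S(w,
  -- u)|²`. Exchanging the two traces identifies these two.
  have hc := hermTrace_comm G fun u v w y => K (S w u) (S y v)
  simp only [← hermTrace_mul_left, ← hermTrace_add]
  have e (u v w y : E) : K ((2⁻¹ : ℝ) • (S u w + S w u)) ((2⁻¹ : ℝ) • (S v y + S y v))
      + 1 / 4 * K (S u w - S w u) (S v y - S y v) =
      2⁻¹ * K (S u w) (S v y) + 2⁻¹ * K (S w u) (S y v) := by
    rw [hs]
    simp only [map_add, map_sub, LinearMap.add_apply, LinearMap.sub_apply]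
    ring
  simp only [e, hermTrace_add, hermTrace_mul_left]
  rw [hc]
  ring

variable [FiniteDimensional ℂ F]
variable {U : Set E} {U' : Set F} {f : E → F} {H : E → E →ₗ[ℂ] E →ₗ⋆[ℂ] ℂ}
  {K : F → F →ₗ[ℂ] F →ₗ⋆[ℂ] ℂ}
variable (hH : LocalMetric U H) (hK : LocalMetric U' K) (hf : LocalMap U U' f)
include hH hK hf

/-- Since `∂_u` and `∂_{v̄}` commute, this is the frame formula of `dzbar_dz_localEnergy`, with
frame sums rewritten as basis-independent traces and `∂̄Γ` as minus the curvature. -/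
lemma dz_dzbar_localEnergy {z : E} (hz : z ∈ U) (u v : E) :
    dz u (dzbar v (localEnergy H K f)) z =
      hermTrace (fun u v => H z u v) (fun w y =>
        K (f z) (chernHessian H K f z u w) (chernHessian H K f z v y))
      + hermTrace (fun u v => H z u v) (fun w' y' => hermTrace (fun u v => H z u v) fun w y =>
        localChernCurvature (fun z u v => H z u v) z u v w' y *
          K (f z) (fderiv ℂ f z w) (fderiv ℂ f z y'))
      - hermTrace (fun u v => H z u v) (fun w y =>
        localChernCurvature (fun z u v => K z u v) (f z) (fderiv ℂ f z u) (fderiv ℂ f z v)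
          (fderiv ℂ f z w) (fderiv ℂ f z y)) := by
  have hd := (hH.posHermitian z hz).isDualPair
  have t1 := hermTrace_eq_sum (fun u v => H z u v) fun y =>
    ((K (f z)).flip (chernHessian H K f z v y)).comp (chernHessian H K f z u)
  have t3 := hermTrace_eq_sum (fun u v => H z u v) fun y =>
    - ((K (f z)).flip (fderiv ℂ f z y)).comp
      ((hK.dzbarChristoffel (hf.mapsTo hz) (fderiv ℂ f z u) (fderiv ℂ f z v)).comp
        (fderiv ℂ f z : E →ₗ[ℂ] F))
  have t2 (y' : E) (c : E → ℂ) := hermTrace_eq_sum (fun u v => H z u v) fun y =>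
    c y • ((K (f z)).flip (fderiv ℂ f z y')).comp (fderiv ℂ f z : E →ₗ[ℂ] F)
  have t4 := hermTrace_eq_sum (fun u v => H z u v) fun y' =>
    ∑ j, K (f z) (fderiv ℂ f z (dualFrame (fun u v => H z u v) j)) (fderiv ℂ f z y') •
      - ((H z).flip (Module.finBasis ℂ E j)).comp (hH.dzbarChristoffel hz u v)
  simp only [LinearMap.comp_apply, LinearMap.flip_apply, LinearMap.neg_apply,
    LinearMap.smul_apply, LinearMap.sum_apply, ContinuousLinearMap.coe_coe, smul_eq_mul]
    at t1 t2 t3 t4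
  rw [dz_dzbar_comm hH.isOpen (smooth_localEnergy hH hK hf) hz, dzbar_dz_localEnergy hH hK hf hz,
    t1]
  simp only [hH.localChernCurvature_eq hz, hK.localChernCurvature_eq (hf.mapsTo hz), t2, t3]
  simp only [mul_comm (-(H z _) _)]
  rw [t4, Finset.sum_neg_distrib, sub_neg_eq_add]
  -- Expanding `∂̄Γ(e_j)` in the dual frame exposes the fourth index of the source curvature and
  -- produces the second trace.
  have e : ∑ j, K (f z) (fderiv ℂ f z (hH.dzbarChristoffel hz u v
        (dualFrame (fun u v => H z u v) j))) (fderiv ℂ f z (Module.finBasis ℂ E j)) =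
      - ∑ j, ∑ k, K (f z) (fderiv ℂ f z (dualFrame (fun u v => H z u v) k))
          (fderiv ℂ f z (Module.finBasis ℂ E j)) *
        -(H z (hH.dzbarChristoffel hz u v (dualFrame (fun u v => H z u v) j))
          (Module.finBasis ℂ E k)) := by
    rw [← Finset.sum_neg_distrib]
    refine Finset.sum_congr rfl fun j _ => ?_
    conv_lhs => rw [← hd.left (hH.dzbarChristoffel hz u v (dualFrame (fun u v => H z u v) j))]
    simp only [map_sum, map_smul, LinearMap.sum_apply, LinearMap.smul_apply, smul_eq_mul,
      mul_neg, Finset.sum_neg_distrib, neg_neg]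
    exact Finset.sum_congr rfl fun k _ => mul_comm _ _
  rw [e]
  ring

/-- The Bochner formula for the energy density of a holomorphic map, in local coordinates. -/
theorem local_bochner {z : E} (hz : z ∈ U) :
    hermTrace (fun u v => H z u v) (fun u v => dz u (dzbar v (localEnergy H K f)) z) =
      hermTrace (fun u v => H z u v) (fun u v => hermTrace (fun u v => H z u v) fun w y =>
        K (f z) ((2⁻¹ : ℝ) • (chernHessian H K f z u w + chernHessian H K f z w u))
          ((2⁻¹ : ℝ) • (chernHessian H K f z v y + chernHessian H K f z y v)))
      + 1 / 4 * hermTrace (fun u v => H z u v) (fun u v => hermTrace (fun u v => H z u v) fun w y =>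
        K (f z)
          (fderiv ℂ f z (localChernTorsion (fun z u v => H z u v) z u w)
            - localChernTorsion (fun z u v => K z u v) (f z) (fderiv ℂ f z u) (fderiv ℂ f z w))
          (fderiv ℂ f z (localChernTorsion (fun z u v => H z u v) z v y)
            - localChernTorsion (fun z u v => K z u v) (f z) (fderiv ℂ f z v) (fderiv ℂ f z y)))
      + hermTrace (fun u v => H z u v) (fun u v => hermTrace (fun u v => H z u v) fun w y =>
        hermTrace (fun u v => H z u v) (fun i j =>
          localChernCurvature (fun z u v => H z u v) z i j u y) *
          K (f z) (fderiv ℂ f z w) (fderiv ℂ f z v))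
      - hermTrace (fun u v => H z u v) (fun u v => hermTrace (fun u v => H z u v) fun w y =>
        localChernCurvature (fun z u v => K z u v) (f z) (fderiv ℂ f z u) (fderiv ℂ f z v)
          (fderiv ℂ f z w) (fderiv ℂ f z y)) := by
  simp only [dz_dzbar_localEnergy hH hK hf hz, hermTrace_sub, hermTrace_add]
  rw [hermTrace_symm_add_antisymm _ _ fun u w => chernHessian H K f z u w]
  -- The second derivative of `f` is symmetric and drops out of the antisymmetrized Hessian, leaving
  -- the torsions. The overall sign disappears in the square.
  have hdef (u w : E) : fderiv ℂ f z (localChernTorsion (fun z u v => H z u v) z u w)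
      - localChernTorsion (fun z u v => K z u v) (f z) (fderiv ℂ f z u) (fderiv ℂ f z w) =
      -(chernHessian H K f z u w - chernHessian H K f z w u) := by
    simp only [localChernTorsion, hH.chernD10_const hz, hK.chernD10_const (hf.mapsTo hz),
      chernHessian_apply, map_sub, hf.fderiv_fderiv_symm hH.isOpen hz u w]
    abel
  -- Two exchanges of traces bring the first curvature pair innermost, where it contracts to the
  -- second Ricci curvature.
  have hric : hermTrace (fun u v => H z u v) (fun u v => hermTrace (fun u v => H z u v)
      fun w' y' => hermTrace (fun u v => H z u v) fun w y =>
        localChernCurvature (fun z u v => H z u v) z u v w' y *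
          K (f z) (fderiv ℂ f z w) (fderiv ℂ f z y')) =
      hermTrace (fun u v => H z u v) (fun u v => hermTrace (fun u v => H z u v) fun w y =>
        hermTrace (fun u v => H z u v) (fun i j =>
          localChernCurvature (fun z u v => H z u v) z i j u y) *
          K (f z) (fderiv ℂ f z w) (fderiv ℂ f z v)) := by
    rw [hermTrace_comm]
    congr 1
    funext u v
    rw [hermTrace_comm]
    congr 1
    funext w y
    simp only [mul_comm _ (K (f z) (fderiv ℂ f z w) (fderiv ℂ f z v)), hermTrace_mul_left]
  simp only [hdef, map_neg, LinearMap.neg_apply, neg_neg]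
  rw [hric]

end LocalFormula

/-! ### Passing to holomorphic charts -/

section Charts

open Topology

variable {E : Type*} [NormedAddCommGroup E] [NormedSpace ℂ E]
  {X : Type*} [TopologicalSpace X] [ChartedSpace E X] [IsManifold 𝓘(ℂ, E) ω X]

variable (E) in
/-- The change of coordinates on tangent vectors at `y`, from the chart at `x` to the chart
at `y`. -/
def tangentChange (x y : X) : E →L[ℂ] E :=
  fderiv ℂ (chartAt E y ∘ (chartAt E x).symm) (chartAt E x y)

omit [IsManifold 𝓘(ℂ, E) ω X] in
lemma tangentCoordChange_complex [IsManifold 𝓘(ℂ, E) 1 X] (x y z : X) :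
    tangentCoordChange 𝓘(ℂ, E) x y z =
      fderiv ℂ (chartAt E y ∘ (chartAt E x).symm) (chartAt E x z) := by
  rw [tangentCoordChange_def]
  simp [mfld_simps]

lemma differentiableAt_coordChange {x y z : X} (hx : z ∈ (chartAt E x).source)
    (hy : z ∈ (chartAt E y).source) :
    DifferentiableAt ℂ (chartAt E y ∘ (chartAt E x).symm) (chartAt E x z) := by
  have : IsManifold 𝓘(ℂ, E) 1 X := .of_le (n := ω) le_top
  have h := hasFDerivWithinAt_tangentCoordChange (I := 𝓘(ℂ, E)) (x := x) (y := y) (z := z)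
    (by simpa using! ⟨hx, hy⟩)
  have h2 := h.differentiableWithinAt
  simpa [mfld_simps, differentiableWithinAt_univ] using h2

/-- Transition maps are holomorphic, so the real tangent bundle has complex linear coordinate
changes. -/
lemma tangentCoordChange_real {x y z : X} (hx : z ∈ (chartAt E x).source)
    (hy : z ∈ (chartAt E y).source) (v : E) :
    haveI : IsManifold 𝓘(ℝ, E) 1 X := .of_le (n := ω) le_top
    tangentCoordChange 𝓘(ℝ, E) x y z v =
      fderiv ℂ (chartAt E y ∘ (chartAt E x).symm) (chartAt E x z) v := by
  have : IsManifold 𝓘(ℝ, E) 1 X := .of_le (n := ω) le_top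
  rw [tangentCoordChange_def, ← fderiv_real_of_holomorphic (differentiableAt_coordChange hx hy)]
  simp [mfld_simps]

lemma tangentChange_self (x : X) : tangentChange E x x = ContinuousLinearMap.id ℂ E := by
  have : IsManifold 𝓘(ℂ, E) 1 X := .of_le (n := ω) le_top
  ext v
  rw [tangentChange, ← tangentCoordChange_complex]
  exact tangentCoordChange_self (by simp)

/-- The change of coordinates on tangent vectors is invertible. -/
def tangentChangeEquiv {x y : X} (hy : y ∈ (chartAt E x).source) : E ≃ₗ[ℂ] E :=
  haveI : IsManifold 𝓘(ℂ, E) 1 X := .of_le (n := ω) le_top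
  LinearEquiv.ofLinearMap (tangentChange E x y : E →ₗ[ℂ] E)
    (tangentCoordChange 𝓘(ℂ, E) y x y : E →ₗ[ℂ] E)
    (by
      ext v
      simp only [tangentChange, ← tangentCoordChange_complex, LinearMap.comp_apply,
        ContinuousLinearMap.coe_coe, LinearMap.id_apply]
      rw [tangentCoordChange_comp (by simpa using hy), tangentCoordChange_self (by simp)])
    (by
      ext v
      simp only [tangentChange, ← tangentCoordChange_complex, LinearMap.comp_apply,
        ContinuousLinearMap.coe_coe, LinearMap.id_apply]
      rw [tangentCoordChange_comp (by simpa using hy), tangentCoordChange_self (by simpa using hy)])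

@[simp] lemma tangentChangeEquiv_apply {x y : X} (hy : y ∈ (chartAt E x).source) (v : E) :
    tangentChangeEquiv hy v = tangentChange E x y v := rfl

variable (E) in
/-- The value at `y` of the coordinate field `v` of the chart at `x`. -/
def coordField (x y : X) (v : E) : E :=
  FiberBundle.extend E (E := (TangentSpace 𝓘(ℝ, E) : X → Type _)) (x := x) v y

lemma trivializationAt_self_snd (x : X) (v : TangentSpace 𝓘(ℝ, E) x) :
    (trivializationAt E (TangentSpace 𝓘(ℝ, E) : X → Type _) x ⟨x, v⟩).2 = v := by
  have : IsManifold 𝓘(ℝ, E) 1 X := .of_le (n := ω) le_top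
  exact tangentCoordChange_self (I := 𝓘(ℝ, E)) (x := x) (z := x) (v := v) (by simp)

lemma coordField_eq_symm (x y : X) (v : E) : coordField E x y v =
    (trivializationAt E (TangentSpace 𝓘(ℝ, E) : X → Type _) x).symm y v := by
  have h : coordField E x y v = (trivializationAt E (TangentSpace 𝓘(ℝ, E) : X → Type _) x).symm y
    (trivializationAt E (TangentSpace 𝓘(ℝ, E) : X → Type _) x ⟨x, v⟩).2 := rfl
  rw [h]
  exact congrArg _ (trivializationAt_self_snd x v)

lemma coordField_of_mem {x y : X} (hy : y ∈ (chartAt E x).source) (v : E) :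
    coordField E x y v = tangentChange E x y v := by
  have : IsManifold 𝓘(ℝ, E) 1 X := .of_le (n := ω) le_top
  rw [tangentChange, ← tangentCoordChange_real hy (by simp), coordField_eq_symm]
  have h1 := TangentBundle.symmL_trivializationAt_eq_core (𝕜 := ℝ) (I := 𝓘(ℝ, E)) hy
  have h2 := congrArg (fun L : E →L[ℝ] E => L v) h1
  rw [← h2]
  exact (Trivialization.symmL_apply _ hy v).symm

lemma trivializationAt_tangentChange {x y : X} (hy : y ∈ (chartAt E x).source) (v : E) :
    (trivializationAt E (TangentSpace 𝓘(ℝ, E) : X → Type _) x ⟨y, tangentChange E x y v⟩).2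
      = v := by
  rw [← coordField_of_mem hy, coordField_eq_symm, Trivialization.apply_mk_symm _ hy]

/-- The metric as a form on the model space. -/
def HermitianMetric.modelForm (g : HermitianMetric E X) (y : X) : E →ₗ[ℂ] E →ₗ⋆[ℂ] ℂ := g.form y

/-- The coefficients of the metric in the chart at `x`. -/
def coeffForm (g : HermitianMetric E X) (x : X) (z : E) : E →ₗ[ℂ] E →ₗ⋆[ℂ] ℂ :=
  pullForm (g.modelForm ((chartAt E x).symm z))
    (tangentChange E x ((chartAt E x).symm z) : E →ₗ[ℂ] E)

/-- Inside the chart the constant-coefficient fields are given by `tangentChange`. `coeffForm`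
packages the result as a genuine sesquilinear form, to which the local theory applies. -/
lemma coeff_eq (g : HermitianMetric E X) {x : X} {z : E} (hz : z ∈ (chartAt E x).target) :
    coeff g.form x z = fun u v => coeffForm g x z u v := by
  have hy := (chartAt E x).map_target hz
  funext u v
  rw [coeffForm, pullForm_apply, ContinuousLinearMap.coe_coe, ← coordField_of_mem hy,
    ← coordField_of_mem hy]
  rfl

lemma coeff_eventuallyEq (g : HermitianMetric E X) {x : X} {z : E}
    (hz : z ∈ (chartAt E x).target) :
    coeff g.form x =ᶠ[𝓝 z] fun z u v => coeffForm g x z u v := by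
  filter_upwards [(chartAt E x).open_target.mem_nhds hz] with z' hz'
  exact coeff_eq g hz'

lemma HermitianMetric.isPosHermitian (g : HermitianMetric E X) (y : X) :
    IsPosHermitian (g.modelForm y) where
  conj_symm := g.conj_symm y
  pos := g.pos y

lemma coeffForm_of_mem (g : HermitianMetric E X) {x y : X} (hy : y ∈ (chartAt E x).source) :
    coeffForm g x (chartAt E x y) =
      pullForm (g.modelForm y) (tangentChangeEquiv hy : E →ₗ[ℂ] E) := by
  rw [coeffForm, (chartAt E x).left_inv hy]
  rfl

lemma coeffForm_self (g : HermitianMetric E X) (x : X) :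
    coeffForm g x (chartAt E x x) = g.modelForm x := by
  rw [coeffForm_of_mem g (mem_chart_source E x)]
  refine LinearMap.ext₂ fun u v => ?_
  simp only [pullForm_apply, LinearEquiv.coe_coe, tangentChangeEquiv_apply, tangentChange_self,
    ContinuousLinearMap.id_apply]

lemma localMetric_coeffForm (g : HermitianMetric E X) (x : X) :
    LocalMetric (chartAt E x).target (coeffForm g x) where
  isOpen := (chartAt E x).open_target
  posHermitian z hz := by
    have hy := (chartAt E x).map_target hz
    have h := coeffForm_of_mem g hy
    rw [(chartAt E x).right_inv hz] at h
    rw [h]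
    exact (g.isPosHermitian _).pullForm _
  smooth u v := by
    refine (g.smooth x u v).congr fun z hz => ?_
    rw [coeff_eq g hz]

lemma LocalMetric.mono {U U' : Set E} {H : E → E →ₗ[ℂ] E →ₗ⋆[ℂ] ℂ} (h : LocalMetric U H)
    (hU' : IsOpen U') (hs : U' ⊆ U) : LocalMetric U' H where
  isOpen := hU'
  posHermitian z hz := h.posHermitian z (hs hz)
  smooth u v := (h.smooth u v).mono hs

variable {F : Type*} [NormedAddCommGroup F] [NormedSpace ℂ F]
  {Y : Type*} [TopologicalSpace Y] [ChartedSpace F Y] [IsManifold 𝓘(ℂ, F) ω Y]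

variable (E F) in
/-- A map in the charts at `x` and `f x`. -/
def inCharts (f : X → Y) (x : X) (z : E) : F := chartAt F (f x) (f ((chartAt E x).symm z))

variable (E F) in
/-- The domain of a map in the charts at `x` and `f x`. -/
def chartDomain (f : X → Y) (x : X) : Set E :=
  (chartAt E x).target ∩ (chartAt E x).symm ⁻¹' (f ⁻¹' (chartAt F (f x)).source)

omit [NormedSpace ℂ E] [NormedSpace ℂ F] [IsManifold 𝓘(ℂ, E) ω X]
  [IsManifold 𝓘(ℂ, F) ω Y] in
lemma mem_chartDomain {f : X → Y} {x y : X} (hy : y ∈ (chartAt E x).source)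
    (hfy : f y ∈ (chartAt F (f x)).source) : chartAt E x y ∈ chartDomain E F f x := by
  refine ⟨(chartAt E x).map_source hy, ?_⟩
  simpa [(chartAt E x).left_inv hy] using hfy

omit [NormedSpace ℂ E] [NormedSpace ℂ F] [IsManifold 𝓘(ℂ, E) ω X]
  [IsManifold 𝓘(ℂ, F) ω Y] in
lemma self_mem_chartDomain (f : X → Y) (x : X) : chartAt E x x ∈ chartDomain E F f x :=
  mem_chartDomain (by simp) (by simp)

omit [NormedSpace ℂ E] [NormedSpace ℂ F] [IsManifold 𝓘(ℂ, E) ω X]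
  [IsManifold 𝓘(ℂ, F) ω Y] in
lemma isOpen_chartDomain {f : X → Y} (hf : Continuous f) (x : X) :
    IsOpen (chartDomain E F f x) :=
  (chartAt E x).isOpen_inter_preimage_symm ((chartAt F (f x)).open_source.preimage hf)

lemma localMap_inCharts {f : X → Y} (hf : ContMDiff 𝓘(ℂ, E) 𝓘(ℂ, F) ω f) (x : X) :
    LocalMap (chartDomain E F f x) (chartAt F (f x)).target (inCharts E F f x) where
  mapsTo z hz := (chartAt F (f x)).map_source hz.2
  holomorphic := by
    have h := (contMDiff_iff.1 hf).2 x (f x)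
    unfold inCharts chartDomain
    simpa [mfld_simps, Function.comp_def] using h

variable (E F) in
/-- The differential of `f` at `y` as a map of model spaces. -/
def modelDel (f : X → Y) (y : X) : E →L[ℂ] F := del f y

omit [IsManifold 𝓘(ℂ, E) ω X] [IsManifold 𝓘(ℂ, F) ω Y] in
lemma modelDel_eq {f : X → Y} (hf : ContMDiff 𝓘(ℂ, E) 𝓘(ℂ, F) ω f) (x : X) :
    modelDel E F f x = fderiv ℂ (inCharts E F f x) (chartAt E x x) := by
  have h := (hf.mdifferentiable (by simp) x).mfderiv
  rw [modelDel, del, h]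
  unfold inCharts
  simp [mfld_simps, writtenInExtChartAt, Function.comp_def]

/-- The differential of `f` near `x`, in the charts at `x` and `f x`. -/
lemma modelDel_tangentChange {f : X → Y} (hf : ContMDiff 𝓘(ℂ, E) 𝓘(ℂ, F) ω f) {x y : X}
    (hy : y ∈ (chartAt E x).source) (hfy : f y ∈ (chartAt F (f x)).source) (v : E) :
    modelDel E F f y (tangentChange E x y v) =
      tangentChange F (f x) (f y) (fderiv ℂ (inCharts E F f x) (chartAt E x y) v) := by
  have hsymm : (chartAt E x).symm (chartAt E x y) = y := (chartAt E x).left_inv hy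
  have hval : inCharts E F f x (chartAt E x y) = chartAt F (f x) (f y) := by
    rw [inCharts, hsymm]
  have d1 := differentiableAt_coordChange hy (mem_chart_source E y)
  have d2 := differentiableAt_coordChange hfy (mem_chart_source F (f y))
  have d3 := (localMap_inCharts hf x).differentiableAt (isOpen_chartDomain hf.continuous x)
    (mem_chartDomain hy hfy)
  have d4 := (localMap_inCharts hf y).differentiableAt (isOpen_chartDomain hf.continuous y)
    (self_mem_chartDomain f y)
  have e1 : (chartAt E y ∘ (chartAt E x).symm) (chartAt E x y) = chartAt E y y := by
    simp [hsymm]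
  rw [← hval] at d2
  rw [← e1] at d4
  have c1 := fderiv_comp (chartAt E x y) d4 d1
  have c2 := fderiv_comp (chartAt E x y) d2 d3
  -- Both composites express `f` from the chart at `x` to the chart at `f y`; the claim compares
  -- their two chain rules.
  have hev : inCharts E F f y ∘ (chartAt E y ∘ (chartAt E x).symm) =ᶠ[𝓝 (chartAt E x y)]
      (chartAt F (f y) ∘ (chartAt F (f x)).symm) ∘ inCharts E F f x := by
    have hc : ContinuousAt (chartAt E x).symm (chartAt E x y) :=
      (chartAt E x).continuousAt_symm ((chartAt E x).map_source hy)
    have n1 : ∀ᶠ z in 𝓝 (chartAt E x y), (chartAt E x).symm z ∈ (chartAt E y).source :=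
      hc.preimage_mem_nhds (by
        rw [hsymm]; exact (chartAt E y).open_source.mem_nhds (mem_chart_source E y))
    have n2 : ∀ᶠ z in 𝓝 (chartAt E x y), z ∈ chartDomain E F f x :=
      (isOpen_chartDomain hf.continuous x).mem_nhds (mem_chartDomain hy hfy)
    filter_upwards [n1, n2] with z h1 h2
    simp only [Function.comp_apply, inCharts]
    rw [(chartAt E y).left_inv h1, (chartAt F (f x)).left_inv h2.2]
  rw [hev.fderiv_eq, c2, e1, hval] at c1
  have := congrArg (fun L : E →L[ℂ] F => L v) c1
  rw [modelDel_eq hf y]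
  exact this.symm

variable [FiniteDimensional ℂ E]

lemma chernD10_congr {H H' : E → E → E → ℂ} {z : E} (h : H =ᶠ[𝓝 z] H') (u : E) (s : E → E) :
    chernD10 H u s z = chernD10 H' u s z := by
  have e (l) : dz u (fun z' => H z' (s z) (Module.finBasis ℂ E l)) z =
      dz u (fun z' => H' z' (s z) (Module.finBasis ℂ E l)) z :=
    dz_congr (h.mono fun z' hz' => by rw [hz']) u
  simp only [chernD10, e, h.eq_of_nhds]

lemma localChernTorsion_congr {H H' : E → E → E → ℂ} {z : E} (h : H =ᶠ[𝓝 z] H') (u v : E) :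
    localChernTorsion H z u v = localChernTorsion H' z u v := by
  simp only [localChernTorsion, chernD10_congr h]

/-- The curvature differentiates the connection form, so the metrics must agree near every point
close to `z`, not merely to first order at `z`. -/
lemma localChernCurvature_congr {H H' : E → E → E → ℂ} {z : E} (h : H =ᶠ[𝓝 z] H')
    (u v w y : E) : localChernCurvature H z u v w y = localChernCurvature H' z u v w y := by
  have e : chernD01 v (chernD10 H u fun _ => w) z = chernD01 v (chernD10 H' u fun _ => w) z :=
    dzbar_congr (h.eventuallyEq_nhds.mono fun z' hz' => chernD10_congr hz' u _) v
  simp only [localChernCurvature, e, chernD10_congr h, h.eq_of_nhds]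

lemma trace_eq (g : HermitianMetric E X) (x : X) (B : E → E → ℂ) :
    trace g x B = hermTrace (fun u v => coeffForm g x (chartAt E x x) u v) B := by
  rw [coeffForm_self]; rfl

/-- The density at `y` is defined in the frame of the chart at `y`, whereas the Laplacian at `x`
differentiates in one fixed chart. Invariance of the trace under the coordinate change reconciles
them. -/
lemma energyDensity_eq (g : HermitianMetric E X) (h : HermitianMetric F Y) {f : X → Y}
    (hf : ContMDiff 𝓘(ℂ, E) 𝓘(ℂ, F) ω f) {x y : X}
    (hy : y ∈ (chartAt E x).source) (hfy : f y ∈ (chartAt F (f x)).source) :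
    energyDensity g h f y =
      localEnergy (coeffForm g x) (coeffForm h (f x)) (inCharts E F f x) (chartAt E x y) := by
  have h1 := hermTrace_pullback (g.isPosHermitian y)
    (pullForm (h.modelForm (f y)) (modelDel E F f y : E →ₗ[ℂ] F)) (tangentChangeEquiv hy)
  have hval : inCharts E F f x (chartAt E x y) = chartAt F (f x) (f y) := by
    rw [inCharts, (chartAt E x).left_inv hy]
  rw [localEnergy, hval, coeffForm_of_mem g hy, coeffForm_of_mem h hfy]
  simp only [pullForm_apply, tangentChangeEquiv_apply, ContinuousLinearMap.coe_coe,
    modelDel_tangentChange hf hy hfy] at h1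
  simp only [pullForm_apply, tangentChangeEquiv_apply, LinearEquiv.coe_coe]
  rw [h1]
  rfl

lemma laplacian_energyDensity (g : HermitianMetric E X) (h : HermitianMetric F Y) {f : X → Y}
    (hf : ContMDiff 𝓘(ℂ, E) 𝓘(ℂ, F) ω f) (x : X) :
    laplacian g (energyDensity g h f) x =
      hermTrace (fun u v => coeffForm g x (chartAt E x x) u v) fun u v =>
        dz u (dzbar v (localEnergy (coeffForm g x) (coeffForm h (f x)) (inCharts E F f x)))
          (chartAt E x x) := by
  rw [laplacian, ← trace_eq]
  have hev (z : E) (hz : z ∈ chartDomain E F f x) :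
      (fun z => energyDensity g h f ((chartAt E x).symm z)) =ᶠ[𝓝 z]
        localEnergy (coeffForm g x) (coeffForm h (f x)) (inCharts E F f x) := by
    filter_upwards [(isOpen_chartDomain hf.continuous x).mem_nhds hz] with z' hz'
    rw [energyDensity_eq g h hf ((chartAt E x).map_target hz'.1) hz'.2,
      (chartAt E x).right_inv hz'.1]
  refine congrArg (trace g x) (funext fun u => funext fun v => ?_)
  refine dz_congr (E := E) ?_ u
  filter_upwards [(isOpen_chartDomain (E := E) (F := F) hf.continuous x).mem_nhds
    (self_mem_chartDomain f x)] with z hz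
  exact dzbar_congr (hev z hz) v

end Charts

/-! ### Suitably skew-symmetric Hermitian connections in holomorphic charts -/

section SkewAlgebra

variable {V : Type*} [NormedAddCommGroup V] [NormedSpace ℂ V] [FiniteDimensional ℂ V]

/-- For a suitably skew-symmetric Hermitian connection with connection form `A`, the symmetric
part of the `(1,0)`-part of `A` agrees with that of the Chern connection. -/
lemma symm_connection_eq {U : Set V} {H : V → V →ₗ[ℂ] V →ₗ⋆[ℂ] ℂ} (hH : LocalMetric U H)
    {z : V} (hz : z ∈ U) (A : V → V → V)
    (metric : ∀ u v w, fderiv ℝ (fun z => H z v w) z u = H z (A u v) w + H z v (A u w))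
    (skew : ∀ u v w, H z (A u v + Complex.I • A (Complex.I • u) v) w =
      - H z (A w v + Complex.I • A (Complex.I • w) v) u) (u v : V) :
    (2⁻¹ : ℂ) • (A u v - Complex.I • A (Complex.I • u) v)
      + (2⁻¹ : ℂ) • (A v u - Complex.I • A (Complex.I • v) u) =
    christoffel H z u v + christoffel H z v u := by
  have hG := hH.posHermitian z hz
  refine hG.ext fun w => ?_
  -- By metric compatibility, these pairings measure the difference between `Γ` and the (1,0)-part
  -- of `A`. Conjugating the torsion condition shows that they cancel after symmetrization in `u`
  -- and `v`.
  have hsk : H z v (A u w + Complex.I • A (Complex.I • u) w) =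
      - H z u (A v w + Complex.I • A (Complex.I • v) w) := by
    rw [hG.conj_symm, skew, map_neg, ← hG.conj_symm]
  simp only [map_add, LinearMap.add_apply, hH.form_christoffel hz, dz, metric]
  simp only [map_smul, map_sub, map_add, LinearMap.smul_apply, LinearMap.sub_apply, smul_eq_mul,
    LinearMap.map_smulₛₗ, Complex.conj_I] at hsk ⊢
  linear_combination (-(1 : ℂ) / 2) * hsk

end SkewAlgebra

/-! ### Connection forms and torsion in the chart at a point -/

section Connections

open Topology

variable {E : Type*} [NormedAddCommGroup E] [NormedSpace ℂ E]
  {X : Type*} [TopologicalSpace X] [ChartedSpace E X] [IsManifold 𝓘(ℂ, E) ω X]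

omit [IsManifold 𝓘(ℂ, E) ω X] in
/-- The derivative of a function on a manifold that is given by `ψ` in the chart at `x`. -/
lemma mfderiv_of_chart {V : Type*} [NormedAddCommGroup V] [NormedSpace ℝ V] {φ : X → V}
    {ψ : E → V} {x : X} (hψ : DifferentiableAt ℝ ψ (chartAt E x x))
    (h : ∀ᶠ y in 𝓝 x, φ y = ψ (chartAt E x y)) :
    mfderiv 𝓘(ℝ, E) 𝓘(ℝ, V) φ x = fderiv ℝ ψ (chartAt E x x) := by
  have hc : ContinuousAt φ x := ContinuousAt.congr
    (hψ.continuousAt.comp ((chartAt E x).continuousAt (mem_chart_source E x)))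
    (h.mono fun y hy => hy.symm)
  have hev : (fun z => φ ((chartAt E x).symm z)) =ᶠ[𝓝 (chartAt E x x)] ψ := by
    have hs : Filter.Tendsto (chartAt E x).symm (𝓝 (chartAt E x x)) (𝓝 x) := by
      have := (chartAt E x).continuousAt_symm (mem_chart_target E x)
      rwa [ContinuousAt, (chartAt E x).left_inv (mem_chart_source E x)] at this
    filter_upwards [hs.eventually h, (chartAt E x).open_target.mem_nhds (mem_chart_target E x)]
      with z h1 h2
    rw [h1, (chartAt E x).right_inv h2]
  have hF : HasFDerivAt (fun z => φ ((chartAt E x).symm z))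
      (fderiv ℝ ψ (chartAt E x x)) (chartAt E x x) :=
    hψ.hasFDerivAt.congr_of_eventuallyEq hev
  have hm : HasMFDerivAt 𝓘(ℝ, E) 𝓘(ℝ, V) φ x (fderiv ℝ ψ (chartAt E x x)) :=
    ⟨hc, hF.hasFDerivWithinAt (s := Set.range 𝓘(ℝ, E))⟩
  exact hm.mfderiv

/-- The connection form of `D` at `x`, in the chart at `x`. -/
def connForm (D : Connection E X) (x : X) (u v : E) : E :=
  D (FiberBundle.extend E (show TangentSpace 𝓘(ℝ, E) x from v)) x u

lemma isDiffAt_extend (x : X) (v : TangentSpace 𝓘(ℝ, E) x) :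
    IsDiffAt (FiberBundle.extend E v) x := by
  have : IsManifold 𝓘(ℝ, E) 2 X := .of_le (n := ω) le_top
  exact FiberBundle.mdifferentiableAt_extend 𝓘(ℝ, E) E v

lemma J_extend_eventuallyEq (x : X) (v : E) :
    ∀ᶠ y in 𝓝 x, J y (FiberBundle.extend E (show TangentSpace 𝓘(ℝ, E) x from v) y) =
      FiberBundle.extend E (show TangentSpace 𝓘(ℝ, E) x from (Complex.I • v : E)) y := by
  filter_upwards [(chartAt E x).open_source.mem_nhds (mem_chart_source E x)] with y hy
  have h (w : E) : FiberBundle.extend E (show TangentSpace 𝓘(ℝ, E) x from w) y =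
      tangentChange E x y w := coordField_of_mem hy w
  rw [h, h, map_smul]
  rfl

lemma isDiffAt_congr {σ τ : ∀ x : X, TangentSpace 𝓘(ℝ, E) x} {x : X}
    (h : ∀ᶠ y in 𝓝 x, σ y = τ y) (hτ : IsDiffAt τ x) : IsDiffAt σ x :=
  hτ.congr_of_eventuallyEq (h.mono fun y hy => by simp only [hy])

/-- Holomorphic transition maps give `J` of the coordinate field of `v` as the coordinate field of
`i v` near `x`; locality of `D` then turns `D J = 0` into linearity. -/
lemma connForm_complex {g : HermitianMetric E X} {D : Connection E X} (hD : IsHermitian g D)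
    (x : X) (u v : E) : connForm D x u (Complex.I • v) = Complex.I • connForm D x u v := by
  have h1 := hD.complex _ x (isDiffAt_extend x v) u
  have hev := J_extend_eventuallyEq x v
  have h2 := D.isCovariantDerivativeOnUniv.congr_of_eventuallyEq
    (isDiffAt_congr hev (isDiffAt_extend x _)) (isDiffAt_extend x _) Filter.univ_mem hev
  rw [h2] at h1
  exact h1

lemma connForm_metric {g : HermitianMetric E X} {D : Connection E X} (hD : IsHermitian g D)
    (x : X) (u v w : E) :
    fderiv ℝ (fun z => coeffForm g x z v w) (chartAt E x x) u =
      g.modelForm x (connForm D x u v) w + g.modelForm x v (connForm D x u w) := by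
  have key (v w u : TangentSpace 𝓘(ℝ, E) x) :
      mfderiv 𝓘(ℝ, E) 𝓘(ℝ, ℂ) (fun y => g.form y (FiberBundle.extend E v y)
        (FiberBundle.extend E w y)) x u =
      g.form x (D (FiberBundle.extend E v) x u) w +
        g.form x v (D (FiberBundle.extend E w) x u) := by
    have h1 := hD.metric _ _ x (isDiffAt_extend x v) (isDiffAt_extend x w) u
    rwa [FiberBundle.extend_apply_self, FiberBundle.extend_apply_self] at h1
  refine Eq.trans ?_ (key v w u)
  have hd : DifferentiableAt ℝ (fun z => coeffForm g x z v w) (chartAt E x x) :=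
    smooth_differentiableAt (chartAt E x).open_target ((localMetric_coeffForm g x).smooth v w)
      (mem_chart_target E x)
  refine (congrArg (fun L : E →L[ℝ] ℂ => L u) (mfderiv_of_chart hd ?_)).symm
  filter_upwards [(chartAt E x).open_source.mem_nhds (mem_chart_source E x)] with y hy
  have h := congrFun (congrFun (coeff_eq g ((chartAt E x).map_source hy)) v) w
  rw [coeff, (chartAt E x).left_inv hy] at h
  exact h

lemma mlieBracket_extend (x : X) (u v : TangentSpace 𝓘(ℝ, E) x) :
    VectorField.mlieBracket 𝓘(ℝ, E) (FiberBundle.extend E u) (FiberBundle.extend E v) x = 0 := by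
  have : IsManifold 𝓘(ℝ, E) 1 X := .of_le (n := ω) le_top
  -- Pulled back to the model space, coordinate fields are constant, so their bracket vanishes.
  have hconst (w : E) :
      VectorField.mpullbackWithin 𝓘(ℝ, E) 𝓘(ℝ, E) (extChartAt 𝓘(ℝ, E) x).symm
        (FiberBundle.extend E (show TangentSpace 𝓘(ℝ, E) x from w)) (Set.range 𝓘(ℝ, E))
        =ᶠ[𝓝 (extChartAt 𝓘(ℝ, E) x x)] fun _ => w := by
    have hx : extChartAt 𝓘(ℝ, E) x x ∈ (chartAt E x).target := by simp
    filter_upwards [(chartAt E x).open_target.mem_nhds hx] with z hz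
    have hy := (chartAt E x).map_target hz
    have hsymm := TangentBundle.symmL_trivializationAt (𝕜 := ℝ) (I := 𝓘(ℝ, E)) hy
    have hinv := isInvertible_mfderivWithin_extChartAt_symm (I := 𝓘(ℝ, E)) (x := x) (y := z)
      (by simpa using hz)
    have h1 : extChartAt 𝓘(ℝ, E) x ((chartAt E x).symm z) = z := by
      simp [(chartAt E x).right_inv hz]
    rw [h1] at hsymm
    have h2 : coordField E x ((chartAt E x).symm z) w =
        (mfderivWithin 𝓘(ℝ, E) 𝓘(ℝ, E) (extChartAt 𝓘(ℝ, E) x).symm (Set.range 𝓘(ℝ, E)) z :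
          E →L[ℝ] E) w := by
      rw [coordField_eq_symm]
      have h3 := congrArg (fun L : E →L[ℝ] E => L w) hsymm
      exact (Trivialization.symmL_apply _ hy w).symm.trans h3
    obtain ⟨e, he⟩ := hinv
    change (mfderivWithin 𝓘(ℝ, E) 𝓘(ℝ, E) (extChartAt 𝓘(ℝ, E) x).symm
      (Set.range 𝓘(ℝ, E)) z : E →L[ℝ] E).inverse (coordField E x ((chartAt E x).symm z) w) = w
    rw [h2]
    have h4 (L : E →L[ℝ] E) (e : E ≃L[ℝ] E) (he : (e : E →L[ℝ] E) = L) (v : E) :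
        L.inverse (L v) = v := by
      rw [← he]; simp
    exact h4 _ e he w
  rw [VectorField.mlieBracket, VectorField.mlieBracketWithin_apply, Set.preimage_univ,
    Set.univ_inter]
  have h5 := Filter.EventuallyEq.lieBracketWithin_vectorField_eq_nhds (𝕜 := ℝ)
    (s := Set.range 𝓘(ℝ, E)) (hconst u) (hconst v)
  have h6 (a b : E) : VectorField.lieBracketWithin ℝ (fun _ : E => a)
      (fun _ : E => b) (Set.range 𝓘(ℝ, E)) (extChartAt 𝓘(ℝ, E) x x) = 0 := by
    simp [VectorField.lieBracketWithin]
  exact (congrArg _ (h5.trans (h6 u v))).trans (map_zero _)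

variable [FiniteDimensional ℂ E]

/-- The torsion of `D` at `x` as a form on the model space. -/
def torsionForm (D : Connection E X) (x : X) (u v : E) : E :=
  haveI : CompleteSpace E := FiniteDimensional.complete ℂ E
  D.torsion x u v

lemma torsionForm_eq (D : Connection E X) (x : X) (u v : E) :
    torsionForm D x u v = connForm D x u v - connForm D x v u := by
  have : CompleteSpace E := FiniteDimensional.complete ℂ E
  have key (u v : TangentSpace 𝓘(ℝ, E) x) : D.torsion x u v =
      D (FiberBundle.extend E v) x u - D (FiberBundle.extend E u) x v := by
    rw [D.torsion_apply_eq_extend, mlieBracket_extend, sub_zero, FiberBundle.extend_apply_self,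
      FiberBundle.extend_apply_self]
  exact key u v

/-- The `(1,1)`-part of the torsion as a form on the model space. -/
def torsionForm11 (D : Connection E X) (x : X) (u v : E) : E := torsion11 D x u v

/-- Complex linearity in the differentiated field cancels every term with derivative along `v`; the
(1,1)-torsion is exactly the (0,1)-part of the connection form. -/
lemma torsionForm11_eq {g : HermitianMetric E X} {D : Connection E X} (hD : IsHermitian g D)
    (x : X) (u v : E) : torsionForm11 D x u v =
      (2⁻¹ : ℂ) • (connForm D x u v + Complex.I • connForm D x (Complex.I • u) v) := by
  have h : torsionForm11 D x u v = (4⁻¹ : ℝ) • (torsionForm D x u v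
      + torsionForm D x (Complex.I • u) (Complex.I • v)
      + Complex.I • (torsionForm D x (Complex.I • u) v
        - torsionForm D x u (Complex.I • v))) := rfl
  rw [h]
  simp only [torsionForm_eq, connForm_complex hD]
  rw [← Complex.coe_smul]
  push_cast
  match_scalars <;> ring_nf <;> norm_num

lemma symm_connForm {g : HermitianMetric E X} {D : Connection E X} (hD : IsHermitian g D)
    (hs : SuitablySkew g D) (x : X) (u v : E) :
    (2⁻¹ : ℂ) • (connForm D x u v - Complex.I • connForm D x (Complex.I • u) v)
      + (2⁻¹ : ℂ) • (connForm D x v u - Complex.I • connForm D x (Complex.I • v) u) =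
    christoffel (coeffForm g x) (chartAt E x x) u v
      + christoffel (coeffForm g x) (chartAt E x x) v u := by
  refine symm_connection_eq (localMetric_coeffForm g x) (mem_chart_target E x) (connForm D x)
    (fun u v w => ?_) (fun u v w => ?_) u v
  · rw [connForm_metric hD, coeffForm_self]
  · have h : g.modelForm x (torsionForm11 D x u v) w = - g.modelForm x (torsionForm11 D x w v) u :=
      hs x u v w
    rw [torsionForm11_eq hD, torsionForm11_eq hD] at h
    rw [coeffForm_self]
    simp only [map_smul, LinearMap.smul_apply, smul_eq_mul] at h
    linear_combination 2 * h

end Connections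

/-! ### The Hessian in holomorphic charts -/

section Hessian

open Topology

variable {E : Type*} [NormedAddCommGroup E] [NormedSpace ℂ E]
  {F : Type*} [NormedAddCommGroup F] [NormedSpace ℂ F]
  {X : Type*} [TopologicalSpace X] [ChartedSpace E X] [IsManifold 𝓘(ℂ, E) ω X]
  {Y : Type*} [TopologicalSpace Y] [ChartedSpace F Y] [IsManifold 𝓘(ℂ, F) ω Y]

variable (E F) in
/-- The real differential of `f` at `x` as a map of model spaces. -/
def modelMfderiv {Z : Type*} [TopologicalSpace Z] [ChartedSpace F Z] (f : X → Z) (x : X) :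
    E →L[ℝ] F :=
  mfderiv 𝓘(ℝ, E) 𝓘(ℝ, F) f x

omit [IsManifold 𝓘(ℂ, E) ω X] [IsManifold 𝓘(ℂ, F) ω Y] in
lemma modelMfderiv_eq {f : X → Y} (hf : ContMDiff 𝓘(ℂ, E) 𝓘(ℂ, F) ω f) (x : X) (u : E) :
    modelMfderiv E F f x u = modelDel E F f x u := by
  have h := (hf.mdifferentiable (by simp) x).hasMFDerivAt
  have hF : HasFDerivWithinAt (𝕜 := ℂ) (inCharts E F f x) (modelDel E F f x)
    (Set.range 𝓘(ℂ, E)) (chartAt E x x) := h.2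
  have hm : HasMFDerivAt 𝓘(ℝ, E) 𝓘(ℝ, F) f x ((modelDel E F f x).restrictScalars ℝ) :=
    ⟨h.1, hF.restrictScalars ℝ⟩
  rw [modelMfderiv, hm.mfderiv]
  rfl

/-- The induced connection as a form on the model spaces. -/
def inducedForm (D : Connection E X) (D' : Connection F Y) (f : X → Y) (x : X) (u v : E) : F :=
  inducedConnection D D' f (del f) x u v

lemma inducedForm_eq (D : Connection E X) (D' : Connection F Y) {f : X → Y}
    (hf : ContMDiff 𝓘(ℂ, E) 𝓘(ℂ, F) ω f) (x : X) (u v : E) :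
    inducedForm D D' f x u v =
      fderiv ℂ (fderiv ℂ (inCharts E F f x)) (chartAt E x x) u v
      + connForm D' (f x) (modelDel E F f x u) (modelDel E F f x v)
      - modelDel E F f x (connForm D x u v) := by
  have h1 : inducedForm D D' f x u v =
      modelMfderiv E F (fun y : X =>
        (trivializationAt F (TangentSpace 𝓘(ℝ, F) : Y → Type _) (f x)
          ⟨f y, modelDel E F f y (coordField E x y v)⟩).2) x u
      + connForm D' (f x) (modelMfderiv E F f x u)
        (modelDel E F f x (coordField E x x v))
      - modelDel E F f x (connForm D x u v) := rfl
  have hU := isOpen_chartDomain (E := E) (F := F) hf.continuous x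
  have hz := self_mem_chartDomain (E := E) (F := F) f x
  have hd := ((localMap_inCharts (E := E) (F := F) hf x).hasFDerivAt_fderiv hU hz v)
  -- In the trivialization at `f x`, the image under `df` of the coordinate field of `v` becomes `z
  -- ↦ df_z(v)`, so its derivative is the second derivative of `f` in charts.
  have h2 : modelMfderiv E F (fun y : X =>
        (trivializationAt F (TangentSpace 𝓘(ℝ, F) : Y → Type _) (f x)
          ⟨f y, modelDel E F f y (coordField E x y v)⟩).2) x =
      fderiv ℝ (fun z => fderiv ℂ (inCharts E F f x) z v) (chartAt E x x) := by
    refine mfderiv_of_chart (hd.differentiableAt.restrictScalars ℝ) ?_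
    filter_upwards [(chartAt E x).open_source.mem_nhds (mem_chart_source E x),
      hf.continuous.continuousAt.preimage_mem_nhds
        ((chartAt F (f x)).open_source.mem_nhds (mem_chart_source F (f x)))] with y hy hfy
    rw [coordField_of_mem hy, modelDel_tangentChange hf hy hfy]
    exact trivializationAt_tangentChange hfy _
  have h3 : coordField E x x v = v := by
    rw [coordField_of_mem (mem_chart_source E x), tangentChange_self]; rfl
  rw [h1, h2, h3, modelMfderiv_eq hf, fderiv_real_of_holomorphic hd.differentiableAt, hd.fderiv]
  rfl

/-- The Hessian as a form on the model spaces. -/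
def hessianForm (D : Connection E X) (D' : Connection F Y) (f : X → Y) (x : X) (u v : E) : F :=
  hessian D D' f x u v

/-- The second derivative of `f` is already complex linear in `u`, so projecting to type (1,0)
changes only the connection forms, which are merely real linear in `u`. -/
lemma hessianForm_eq (D : Connection E X) (D' : Connection F Y)
    {f : X → Y} (hf : ContMDiff 𝓘(ℂ, E) 𝓘(ℂ, F) ω f) (x : X) (u v : E) :
    hessianForm D D' f x u v =
      fderiv ℂ (fderiv ℂ (inCharts E F f x)) (chartAt E x x) u v
      + (2⁻¹ : ℂ) • (connForm D' (f x) (modelDel E F f x u) (modelDel E F f x v)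
        - Complex.I • connForm D' (f x) (Complex.I • modelDel E F f x u) (modelDel E F f x v))
      - modelDel E F f x ((2⁻¹ : ℂ) •
        (connForm D x u v - Complex.I • connForm D x (Complex.I • u) v)) := by
  have h1 : hessianForm D D' f x u v = (2⁻¹ : ℝ) • (inducedForm D D' f x u v
      - Complex.I • inducedForm D D' f x (Complex.I • u) v) := rfl
  rw [h1, inducedForm_eq D D' hf, inducedForm_eq D D' hf, ← Complex.coe_smul]
  simp only [map_smul, map_sub, smul_apply, smul_add, smul_sub, smul_smul]
  push_cast
  match_scalars <;> norm_num

variable [FiniteDimensional ℂ E] [FiniteDimensional ℂ F]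

/-- The symmetric part of the Hessian as a form on the model spaces. -/
def symHessianForm (D : Connection E X) (D' : Connection F Y) (f : X → Y) (x : X) (u v : E) : F :=
  symHessian D D' f x u v

/-- The right-hand side no longer mentions the connections, so this serves both the formula and the
uniqueness statement. `symm_connForm` is used at `x`, after applying `df`, and at `f x` on the
images of `u` and `v`. -/
lemma symHessianForm_eq {g : HermitianMetric E X} {h : HermitianMetric F Y}
    {D : Connection E X} {D' : Connection F Y} (hD : IsHermitian g D) (hs : SuitablySkew g D)
    (hD' : IsHermitian h D') (hs' : SuitablySkew h D')
    {f : X → Y} (hf : ContMDiff 𝓘(ℂ, E) 𝓘(ℂ, F) ω f) (x : X) (u v : E) :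
    symHessianForm D D' f x u v = (2⁻¹ : ℝ) •
      (chernHessian (coeffForm g x) (coeffForm h (f x)) (inCharts E F f x) (chartAt E x x) u v
      + chernHessian (coeffForm g x) (coeffForm h (f x)) (inCharts E F f x) (chartAt E x x) v u)
      := by
  have h1 : symHessianForm D D' f x u v =
    (2⁻¹ : ℝ) • (hessianForm D D' f x u v + hessianForm D D' f x v u) := rfl
  have hval : inCharts E F f x (chartAt E x x) = chartAt F (f x) (f x) := by
    rw [inCharts, (chartAt E x).left_inv (mem_chart_source E x)]
  have e1 := congrArg (modelDel E F f x) (symm_connForm hD hs x u v)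
  have e2 := symm_connForm hD' hs' (f x) (modelDel E F f x u) (modelDel E F f x v)
  rw [map_add, map_add] at e1
  rw [h1, hessianForm_eq D D' hf, hessianForm_eq D D' hf, chernHessian_apply,
    chernHessian_apply, hval, ← modelDel_eq hf]
  congr 1
  linear_combination (norm := module) e2 - e1

end Hessian

/-! ### From the local formula to the manifold -/

section Main

variable {E : Type*} [NormedAddCommGroup E] [NormedSpace ℂ E] [FiniteDimensional ℂ E]
  {F : Type*} [NormedAddCommGroup F] [NormedSpace ℂ F] [FiniteDimensional ℂ F]
  {X : Type*} [TopologicalSpace X] [ChartedSpace E X] [IsManifold 𝓘(ℂ, E) ω X]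
  {Y : Type*} [TopologicalSpace Y] [ChartedSpace F Y] [IsManifold 𝓘(ℂ, F) ω Y]

theorem laplacian_energyDensity_eq (g : HermitianMetric E X) (h : HermitianMetric F Y)
    {f : X → Y} (hf : ContMDiff 𝓘(ℂ, E) 𝓘(ℂ, F) ω f)
    {D : Connection E X} {D' : Connection F Y} (hD : IsHermitian g D) (hs : SuitablySkew g D)
    (hD' : IsHermitian h D') (hs' : SuitablySkew h D') (x : X) :
    laplacian g (energyDensity g h f) x =
      normSq g h f x (symHessian D D' f x)
        + 1 / 4 * normSq g h f x (torsionDefect g h f x)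
        + ricciTerm g h f x - curvatureTerm g h f x := by
  have hval : inCharts E F f x (chartAt E x x) = chartAt F (f x) (f x) := by
    rw [inCharts, (chartAt E x).left_inv (mem_chart_source E x)]
  have hmain := local_bochner ((localMetric_coeffForm g x).mono
    (isOpen_chartDomain hf.continuous x) Set.inter_subset_left)
    (localMetric_coeffForm h (f x)) (localMap_inCharts hf x) (self_mem_chartDomain f x)
  rw [laplacian_energyDensity g h hf, hmain, hval]
  have cg := coeff_eventuallyEq g (mem_chart_target E x)
  have ch := coeff_eventuallyEq h (mem_chart_target F (f x))
  -- At the base point the coordinate change is the identity, so the global terms unfold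
  -- definitionally to local traces once `coeffForm_self` is applied.
  have n1 : normSq g h f x (symHessian D D' f x) =
      hermTrace (fun u v => coeffForm g x (chartAt E x x) u v) fun u v =>
        hermTrace (fun u v => coeffForm g x (chartAt E x x) u v) fun w y =>
          h.modelForm (f x) (symHessianForm D D' f x u w) (symHessianForm D D' f x v y) := by
    rw [coeffForm_self]; rfl
  have n2 : normSq g h f x (torsionDefect g h f x) =
      hermTrace (fun u v => coeffForm g x (chartAt E x x) u v) fun u v =>
        hermTrace (fun u v => coeffForm g x (chartAt E x x) u v) fun w y =>
          h.modelForm (f x)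
            (modelDel E F f x (localChernTorsion (coeff g.form x) (chartAt E x x) u w)
              - localChernTorsion (coeff h.form (f x)) (chartAt F (f x) (f x))
                (modelDel E F f x u) (modelDel E F f x w))
            (modelDel E F f x (localChernTorsion (coeff g.form x) (chartAt E x x) v y)
              - localChernTorsion (coeff h.form (f x)) (chartAt F (f x) (f x))
                (modelDel E F f x v) (modelDel E F f x y)) := by
    rw [coeffForm_self]; rfl
  have n3 : ricciTerm g h f x =
      hermTrace (fun u v => coeffForm g x (chartAt E x x) u v) fun u v =>
        hermTrace (fun u v => coeffForm g x (chartAt E x x) u v) fun w y =>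
          (hermTrace (fun u v => coeffForm g x (chartAt E x x) u v) fun i j =>
            localChernCurvature (coeff g.form x) (chartAt E x x) i j u y) *
          h.modelForm (f x) (modelDel E F f x w) (modelDel E F f x v) := by
    rw [coeffForm_self]; rfl
  have n4 : curvatureTerm g h f x =
      hermTrace (fun u v => coeffForm g x (chartAt E x x) u v) fun u v =>
        hermTrace (fun u v => coeffForm g x (chartAt E x x) u v) fun w y =>
          localChernCurvature (coeff h.form (f x)) (chartAt F (f x) (f x))
            (modelDel E F f x u) (modelDel E F f x v)
            (modelDel E F f x w) (modelDel E F f x y) := by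
    rw [coeffForm_self]; rfl
  rw [n1, n2, n3, n4, coeffForm_self h]
  simp only [localChernTorsion_congr cg, localChernTorsion_congr ch,
    localChernCurvature_congr cg, localChernCurvature_congr ch, modelDel_eq hf,
    symHessianForm_eq hD hs hD' hs' hf]

end Main

end HermGeom

end
open HermGeom in
theorem theorem1p3
    {E : Type*} [NormedAddCommGroup E] [NormedSpace ℂ E] [FiniteDimensional ℂ E]
    {F : Type*} [NormedAddCommGroup F] [NormedSpace ℂ F] [FiniteDimensional ℂ F]
    {X : Type*} [TopologicalSpace X] [ChartedSpace E X] [IsManifold 𝓘(ℂ, E) ω X]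
    {Y : Type*} [TopologicalSpace Y] [ChartedSpace F Y] [IsManifold 𝓘(ℂ, F) ω Y]
    (g : HermitianMetric E X) (h : HermitianMetric F Y)
    (f : X → Y) (hf : ContMDiff 𝓘(ℂ, E) 𝓘(ℂ, F) ω f) :
    (∀ (D : Connection E X) (D' : Connection F Y),
      IsHermitian g D → SuitablySkew g D → IsHermitian h D' → SuitablySkew h D' →
      ∀ x : X, laplacian g (energyDensity g h f) x =
        normSq g h f x (symHessian D D' f x)
          + 1 / 4 * normSq g h f x (torsionDefect g h f x)
          + ricciTerm g h f x - curvatureTerm g h f x) ∧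
    (∀ (D₁ D₂ : Connection E X) (D₁' D₂' : Connection F Y),
      IsHermitian g D₁ → SuitablySkew g D₁ → IsHermitian h D₁' → SuitablySkew h D₁' →
      IsHermitian g D₂ → SuitablySkew g D₂ → IsHermitian h D₂' → SuitablySkew h D₂' →
      ∀ (x : X) (u v : TangentSpace 𝓘(ℝ, E) x),
        symHessian D₁ D₁' f x u v = symHessian D₂ D₂' f x u v) := by
  refine ⟨fun D D' hD hs hD' hs' x => laplacian_energyDensity_eq g h hf hD hs hD' hs' x, ?_⟩
  intro D₁ D₂ D₁' D₂' h₁ s₁ h₁' s₁' h₂ s₂ h₂' s₂' x u v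
  exact (symHessianForm_eq h₁ s₁ h₁' s₁' hf x u v).trans
    (symHessianForm_eq h₂ s₂ h₂' s₂' hf x u v).symm
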